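/- For $c>0$, a real $\alpha\ge 0$ and $n\in\mathbb N$ let $P_n(c,\alpha)$ be the probability that the random graph $G(n,p=c/n)$ has an independent set of size $\lceil \alpha n\rceil$. Put $$\alpha_{\mathrm{crit}}^-(c)=\sup\{\alpha\ge 0:\lim_{n\to\infty}P_n(c,\alpha)=1\},\qquad \alpha_{\mathrm{crit}}^+(c)=\inf\{\alpha\ge 0:\lim_{n\to\infty}P_n(c,\alpha)=0\}.$$ Call $a$ a critical density for $c$, written $\alpha_{\mathrm{crit}}(c)=a$, if for all $\alpha\ge 0$ one has $\lim_{n\to\infty}P_n(c,\alpha)=1$ when $\alpha<a$ and $\lim_{n\to\infty}P_n(c,\alpha)=0$ when $\alpha>a$. For $z>0$ let $W(z)$ denote the unique positive root $x$ of the equation $x\mathrm e^x=z$. Then for every $c>0$ $$\alpha_{\mathrm{crit}}^-(c)\le\alpha_{\mathrm{crit}}^+(c)\le\frac2c\,W\!\left(\frac{\mathrm e c}{2}\right),$$ and for every constant $y>4\sqrt2/\mathrm e$ there is a $c_0>0$ (depending only on $y$) such that for all $c\ge c_0$ $$\frac2c\,W\!\left(\frac{\mathrm e c}{2}\right)-y\,\frac{\sqrt{\ln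 c}}{c^{3/2}}\le\alpha_{\mathrm{crit}}^-(c).$$ Moreover, if $a$ is a critical density for $c>0$, then $\alpha_{\mathrm{crit}}^-(c)=\alpha_{\mathrm{crit}}^+(c)=a$. Consequently $$\frac2c\,W\!\left(\frac{\mathrm e c}{2}\right)-y\,\frac{\sqrt{\ln c}}{c^{3/2}}\le\alpha_{\mathrm{crit}}(c)\le\frac2c\,W\!\left(\frac{\mathrm e c}{2}\right),$$ where the upper bound holds for every $c>0$ and the lower bound for all $c\ge c_0$. -/

import Mathlib

open Filter Topology

namespace IndepSetThreshold

theorem existsUnique_pos_mul_exp_eq {z : ℝ} (hz : 0 < z) :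
    ∃! x : ℝ, 0 < x ∧ x * Real.exp x = z := by
  have hmono : ∀ x y : ℝ, 0 < x → x < y → x * Real.exp x < y * Real.exp y := by
    intro x y hx hxy
    exact mul_lt_mul hxy (Real.exp_le_exp.2 hxy.le) (Real.exp_pos x) (hx.trans hxy).le
  have hcont : ContinuousOn (fun x : ℝ => x * Real.exp x) (Set.Icc 0 z) := by fun_prop
  have hmem : z ∈ Set.Icc ((0 : ℝ) * Real.exp 0) (z * Real.exp z) := by
    refine ⟨by simpa using hz.le, ?_⟩
    nlinarith [Real.one_le_exp hz.le]
  obtain ⟨x, hx, hxz⟩ := intermediate_value_Icc hz.le hcont hmem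
  have hxz' : x * Real.exp x = z := hxz
  have hx0 : 0 < x := by
    rcases hx.1.lt_or_eq with h | h
    · exact h
    · rw [← h] at hxz'
      simp at hxz'
      exact absurd hxz' hz.ne
  refine ⟨x, ⟨hx0, hxz'⟩, ?_⟩
  rintro y ⟨hy0, hyz⟩
  rcases lt_trichotomy y x with h | h | h
  · exact absurd (hyz.trans hxz'.symm) (hmono y x hy0 h).ne
  · exact h
  · exact absurd (hxz'.trans hyz.symm) (hmono x y hx0 h).ne

open Classical in
/-- The Lambert function: for `z > 0`, `lambertW z` is the unique positive root `x` of
`x * exp x = z` (and `0` for `z ≤ 0`, a case that is not used). -/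
noncomputable def lambertW (z : ℝ) : ℝ :=
  if hz : 0 < z then (existsUnique_pos_mul_exp_eq hz).choose else 0

/-- The edge probability `c / n`, truncated to the unit interval (for `c > 0` the truncation
only acts when `n < c`). -/
noncomputable def edgeProb (c : ℝ) (n : ℕ) : unitInterval :=
  Set.projIcc (0 : ℝ) 1 zero_le_one (c / n)

/-- The probability that the binomial random graph `G(n, p = c / n)` has an independent set of
size `α n` (rounded up to an integer). -/
noncomputable def probIndep (c α : ℝ) (n : ℕ) : ℝ :=
  (SimpleGraph.binomialRandom (Fin n) (edgeProb c n)).real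
    {G | ∃ s : Finset (Fin n), G.IsNIndepSet ⌈α * n⌉₊ s}

/-- `a` is a sharp threshold for the density of the largest independent set of
`G(n, p = c / n)`: smaller densities occur with probability tending to `1`, larger ones with
probability tending to `0`. -/
def IsAlphaCrit (c a : ℝ) : Prop :=
  (∀ α : ℝ, 0 ≤ α → α < a → Tendsto (probIndep c α) atTop (𝓝 1)) ∧
  (∀ α : ℝ, 0 ≤ α → a < α → Tendsto (probIndep c α) atTop (𝓝 0))

/-- The supremum of the densities of independent sets that exist with high probability. -/
noncomputable def alphaCritLower (c : ℝ) : ℝ :=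
  sSup {α : ℝ | 0 ≤ α ∧ Tendsto (probIndep c α) atTop (𝓝 1)}

/-- The infimum of the densities of independent sets that with high probability do not exist. -/
noncomputable def alphaCritUpper (c : ℝ) : ℝ :=
  sInf {α : ℝ | 0 ≤ α ∧ Tendsto (probIndep c α) atTop (𝓝 0)}

end IndepSetThreshold

/-!
Write `W = W(e c / 2)` and `a = 2 W / c`. Then `a = exp (1 - W)`, and `a` is the root of the
exponent `α (1 - log α) - c α² / 2` of the expected number of independent sets of density `α`.
Above `a` this expectation tends to `0` (`tendsto_probIndep_zero`), which gives the upper bound for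
every `c`.

For the lower bound put `r = √a`. The error term `y √(log c) / c ^ (3 / 2)` is at least
`u r³ / W` with `u = y / (2 √2) > 2 / e` (`mul_cube_div_le`), so that it suffices to find
independent sets of density `a - u r³ / W` with high probability. Split the vertices into blocks
of `m ≈ W⁴` vertices, and count the independent sets with at most one vertex per block. The
restriction to transversals costs only a factor `exp (O(m a² n))` in the first moment. The second
moment method (`inv_le_pi_edgeLaw_real_exists`) bounds the probability that an independent
transversal of density `α` exists from below by the inverse of a sum over the overlaps `x = l / n`
of two transversals:

* if `x ≤ 2 α²`, the term is at most `exp (4 W a³ n)`, up to a constant factor;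
* if `2 α² ≤ x ≤ α / 2`, a Poisson type bound for the overlap (`sum_pow_card_agreement_le`) shows
  that the term is negligible (`overlap_exponent_small_nonpos`);
* if `α / 2 ≤ x`, a union bound (`card_filter_card_agreement_le`) shows that the term is negligible
  as soon as the first moment exponent at `α` exceeds `(2 / e) r³` by a constant factor
  (`overlap_exponent_large_nonpos`). At `α = a - v r³ / W` that exponent is about `v r³`; this is
  where the constant `2 / e`, and hence `4 √2 / e`, comes from.

Hence independent transversals of density `α` exist with probability at least
`exp (- 5 W a³ n)` for large `n`. This is small, but the size of the largest one is a function of about `n / m`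
independent parts of the random graph, each of which changes it by at most `1`. By the
bounded differences inequality a deviation by `τ n` has probability at most `exp (- 2 τ² m n)`, so
the size is concentrated in a window of width `O(√(W a³ / m) n)`
(`measureReal_le_sub_of_bounded_diff`). As `m ≈ W⁴`, this is of smaller order than `r³ n / W`, so
densities slightly below `α` are attained with high probability
(`tendsto_probIndep_one_of_bounds`).
-/

namespace IndepSetThreshold

open MeasureTheory ProbabilityTheory

/-! ### Bounded differences -/

/-- McDiarmid's inequality in exponential form, for independent variables that are exposed in `N`
groups (the fibres of `b`). By induction on `N`: conditionally on the other groups, the function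
has oscillation at most `1` in the last group, so that Hoeffding's lemma applies, and averaging
over the last group keeps the bounded differences in the remaining ones. -/
theorem mgf_sub_integral_le_of_bounded_diff {X : Type} [Finite X] [MeasurableSpace X]
    [DiscreteMeasurableSpace X] (N : ℕ) (t : ℝ) :
    ∀ {ι : Type} [Fintype ι] (μ : ι → Measure X) [∀ i, IsProbabilityMeasure (μ i)]
      (b : ι → ℕ) (_ : ∀ i, b i < N) (f : (ι → X) → ℝ)
      (_ : ∀ k ω ω', (∀ i, b i ≠ k → ω i = ω' i) → |f ω - f ω'| ≤ 1),
      ∫ ω, Real.exp (t * (f ω - ∫ ω', f ω' ∂Measure.pi μ)) ∂Measure.pi μ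
        ≤ Real.exp (N * t ^ 2 / 8) := by
  induction N with
  | zero =>
    intro ι _ μ _ b hb f hf
    have : IsEmpty ι := ⟨fun i => absurd (hb i) (by simp)⟩
    have hc : ∀ ω, f ω = f (fun i => isEmptyElim i) := fun ω => by
      congr 1; exact Subsingleton.elim _ _
    have h2 : ∫ ω', f ω' ∂Measure.pi μ = f (fun i => isEmptyElim i) := by
      rw [integral_congr_ae (Filter.Eventually.of_forall hc)]; simp
    rw [h2, integral_congr_ae (g := fun _ => 1)
      (Filter.Eventually.of_forall fun ω => by simp [hc ω])]
    simp
  | succ N ih =>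
    intro ι _ μ _ b hb f hf
    classical
    let p : ι → Prop := fun i => b i < N
    let μ₁ : Measure ({i // p i} → X) := Measure.pi fun i => μ i
    let μ₂ : Measure ({i // ¬ p i} → X) := Measure.pi fun i => μ i
    let e := MeasurableEquiv.piEquivPiSubtypeProd (fun _ : ι => X) p
    have hmp : MeasurePreserving e (Measure.pi μ) (μ₁.prod μ₂) :=
      measurePreserving_piEquivPiSubtypeProd μ p
    have key : ∀ F : (ι → X) → ℝ, ∫ ω, F ω ∂Measure.pi μ
        = ∫ x, ∫ y, F (e.symm (x, y)) ∂μ₂ ∂μ₁ := by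
      intro F
      rw [← integral_prod (fun z => F (e.symm z)) (Integrable.of_finite),
        ← hmp.integral_comp e.measurableEmbedding]
      simp
    let g : ({i // p i} → X) → ℝ := fun x => ∫ y, f (e.symm (x, y)) ∂μ₂
    have he : ∀ x y i, e.symm (x, y) i = if h : p i then x ⟨i, h⟩ else y ⟨i, h⟩ := by
      intro x y i
      rfl
    have hg : ∀ k x x', (∀ i : {i // p i}, b i ≠ k → x i = x' i) → |g x - g x'| ≤ 1 := by
      intro k x x' h
      have h1 : ∀ y, |f (e.symm (x, y)) - f (e.symm (x', y))| ≤ 1 := by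
        intro y
        apply hf k
        intro i hi
        rw [he, he]
        split_ifs with hp
        · exact h ⟨i, hp⟩ hi
        · rfl
      simp only [g]
      rw [← integral_sub Integrable.of_finite Integrable.of_finite]
      calc _ ≤ ∫ y, |f (e.symm (x, y)) - f (e.symm (x', y))| ∂μ₂ := abs_integral_le_integral_abs
        _ ≤ ∫ y, 1 ∂μ₂ := integral_mono Integrable.of_finite Integrable.of_finite h1
        _ = 1 := by simp
    have hin : ∀ x, ∫ y, Real.exp (t * (f (e.symm (x, y)) - g x)) ∂μ₂ ≤ Real.exp (t ^ 2 / 8) := by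
      intro x
      have hne : (Set.univ : Set ({i // ¬ p i} → X)).Nonempty := by
        by_contra hcon
        have := IsProbabilityMeasure.measure_univ (μ := μ₂)
        rw [Set.not_nonempty_iff_eq_empty.1 hcon] at this
        simp at this
      have : Nonempty ({i // ¬ p i} → X) := ⟨hne.some⟩
      obtain ⟨y₀, hy₀⟩ := Finite.exists_min (fun y => f (e.symm (x, y)))
      have hb' : ∀ y, f (e.symm (x, y)) ∈ Set.Icc (f (e.symm (x, y₀))) (f (e.symm (x, y₀)) + 1) := by
        intro y
        refine ⟨hy₀ y, ?_⟩
        have := hf N (e.symm (x, y)) (e.symm (x, y₀)) (by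
          intro i hi
          rw [he, he, dif_pos (show p i from ?_), dif_pos]
          have := hb i
          show b i < N
          omega)
        linarith [abs_le.1 this]
      have := hasSubgaussianMGF_of_mem_Icc (μ := μ₂) (X := fun y => f (e.symm (x, y)))
        (measurable_of_finite _).aemeasurable (Filter.Eventually.of_forall hb')
      have := this.mgf_le t
      simp only [mgf] at this
      refine this.trans_eq ?_
      congr 1
      simp
      ring
    have hint : ∫ ω', f ω' ∂Measure.pi μ = ∫ x, g x ∂μ₁ := key f
    rw [key, hint]
    calc _ = ∫ x, Real.exp (t * (g x - ∫ x, g x ∂μ₁)) *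
          ∫ y, Real.exp (t * (f (e.symm (x, y)) - g x)) ∂μ₂ ∂μ₁ := by
          congr 1; ext x
          rw [← integral_const_mul]
          congr 1; ext y
          rw [← Real.exp_add]; ring_nf
      _ ≤ ∫ x, Real.exp (t * (g x - ∫ x, g x ∂μ₁)) * Real.exp (t ^ 2 / 8) ∂μ₁ := by
          apply integral_mono Integrable.of_finite Integrable.of_finite
          intro x
          exact mul_le_mul_of_nonneg_left (hin x) (Real.exp_pos _).le
      _ ≤ Real.exp (N * t ^ 2 / 8) * Real.exp (t ^ 2 / 8) := by
          rw [integral_mul_const]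
          gcongr
          exact ih (fun i : {i // p i} => μ i) (fun i => b i) (fun i => i.2) g hg
      _ = _ := by rw [← Real.exp_add]; push_cast; ring_nf

/-- The bounded differences inequality for the upper tail. -/
theorem measureReal_ge_le_of_bounded_diff {X : Type} [Finite X] [MeasurableSpace X]
    [DiscreteMeasurableSpace X] {N : ℕ} (hN : 0 < N)
    {ι : Type} [Fintype ι] (μ : ι → Measure X) [∀ i, IsProbabilityMeasure (μ i)]
    (b : ι → ℕ) (hb : ∀ i, b i < N) (f : (ι → X) → ℝ)
    (hf : ∀ k ω ω', (∀ i, b i ≠ k → ω i = ω' i) → |f ω - f ω'| ≤ 1) {s : ℝ} (hs : 0 ≤ s) :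
    (Measure.pi μ).real {ω | s ≤ f ω - ∫ ω', f ω' ∂Measure.pi μ}
      ≤ Real.exp (-(2 * s ^ 2 / N)) := by
  have hN' : (0 : ℝ) < N := by exact_mod_cast hN
  have h := measure_ge_le_exp_mul_mgf (μ := Measure.pi μ)
    (X := fun ω => f ω - ∫ ω', f ω' ∂Measure.pi μ) s
    (t := 4 * s / N) (by positivity) Integrable.of_finite
  refine h.trans ?_
  have h2 := mgf_sub_integral_le_of_bounded_diff N (4 * s / N) μ b hb f hf
  calc _ ≤ Real.exp (-(4 * s / N) * s) * Real.exp (N * (4 * s / N) ^ 2 / 8) := by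
        gcongr; exact h2
    _ = _ := by
        rw [← Real.exp_add]; congr 1; field_simp; ring

/-- The upper deviation inequality turns an exponentially small lower bound for the upper tail
into a lower bound for the mean; the lower deviation inequality then shows that the values more
than twice the deviation below are unlikely. -/
theorem measureReal_le_sub_of_bounded_diff {X : Type} [Finite X] [MeasurableSpace X]
    [DiscreteMeasurableSpace X] {N : ℕ} (hN : 0 < N)
    {ι : Type} [Fintype ι] (μ : ι → Measure X) [∀ i, IsProbabilityMeasure (μ i)]
    (b : ι → ℕ) (hb : ∀ i, b i < N) (f : (ι → X) → ℝ)
    (hf : ∀ k ω ω', (∀ i, b i ≠ k → ω i = ω' i) → |f ω - f ω'| ≤ 1) {s K : ℝ} (hs : 0 ≤ s)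
    (hK : Real.exp (-(2 * s ^ 2 / N)) < (Measure.pi μ).real {ω | K ≤ f ω}) :
    (Measure.pi μ).real {ω | f ω ≤ K - 2 * s} ≤ Real.exp (-(2 * s ^ 2 / N)) := by
  have hmean : K - s < ∫ ω, f ω ∂Measure.pi μ := by
    by_contra hcon
    push Not at hcon
    refine absurd (measureReal_ge_le_of_bounded_diff hN μ b hb f hf hs) (not_le.2 (hK.trans_le ?_))
    refine measureReal_mono ?_
    intro ω hω
    simp only [Set.mem_ofPred_eq] at hω ⊢
    linarith
  have h := measureReal_ge_le_of_bounded_diff hN μ b hb (fun ω => -f ω) (by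
    intro k ω ω' h
    rw [neg_sub_neg, abs_sub_comm]
    exact hf k ω ω' h) hs
  refine le_trans (measureReal_mono ?_) h
  intro ω hω
  simp only [Set.mem_ofPred_eq, integral_neg] at hω ⊢
  linarith

/-! ### The random graph as a product, and the second moment -/

/-- The law of the indicator of the edge `e` in the binomial random graph with edge probability
`p`; on a loop it is concentrated at `False`. -/
noncomputable def edgeLaw (V : Type) (p : unitInterval) (e : Sym2 V) : Measure Prop :=
  unitInterval.toNNReal p • Measure.dirac (e ∈ (Sym2.diagSetᶜ : Set (Sym2 V))) +
    unitInterval.toNNReal (unitInterval.symm p) • Measure.dirac False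

instance (V : Type) (p : unitInterval) (e : Sym2 V) : IsProbabilityMeasure (edgeLaw V p e) := by
  unfold edgeLaw
  infer_instance

/-- `S` spans no edge of the edge configuration `ω`; the values of `ω` on loops are ignored. -/
def SpansNoEdge {V : Type} (ω : Sym2 V → Prop) (S : Finset V) : Prop :=
  ∀ u ∈ S, ∀ v ∈ S, u ≠ v → ¬ ω s(u, v)

theorem isIndepSet_fromEdgeSet_iff {V : Type} (ω : Sym2 V → Prop) (S : Finset V) :
    (SimpleGraph.fromEdgeSet {e | ω e}).IsIndepSet S ↔ SpansNoEdge ω S := by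
  unfold SimpleGraph.IsIndepSet SpansNoEdge Set.Pairwise
  simp only [SimpleGraph.fromEdgeSet_adj, Finset.mem_coe, Set.mem_ofPred_eq]
  constructor
  · intro h u hu v hv huv hω
    exact h hu hv huv ⟨hω, huv⟩
  · intro h u hu v hv huv hω
    exact h u hu v hv huv hω.1

theorem binomialRandom_real_eq_pi {V : Type} [Fintype V] (p : unitInterval)
    (A : Set (SimpleGraph V)) :
    (SimpleGraph.binomialRandom V p).real A
      = (Measure.pi (edgeLaw V p)).real {ω | SimpleGraph.fromEdgeSet {e | ω e} ∈ A} := by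
  rw [SimpleGraph.binomialRandom_eq_map, setBernoulli_eq_map, Measure.infinitePi_eq_pi,
    Measure.map_map SimpleGraph.measurable_fromEdgeSet (measurable_of_finite _),
    measureReal_def, Measure.map_apply (measurable_of_finite _) ?_]
  · rfl
  · rw [← SimpleGraph.measurableEmbedding_edgeSet.measurableSet_image]
    exact (Set.toFinite _).measurableSet

theorem pi_edgeLaw_real_forall_not {V : Type} [Fintype V] (p : unitInterval)
    (F : Finset (Sym2 V)) (hF : ∀ e ∈ F, ¬ e.IsDiag) :
    (Measure.pi (edgeLaw V p)).real {ω | ∀ e ∈ F, ¬ ω e} = (1 - p : ℝ) ^ F.card := by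
  classical
  have h : {ω : Sym2 V → Prop | ∀ e ∈ F, ¬ ω e}
      = Set.pi Set.univ fun e => if e ∈ F then {False} else Set.univ := by
    ext ω
    simp only [Set.mem_ofPred_eq, Set.mem_pi, Set.mem_univ, true_implies]
    refine forall_congr' fun e => ?_
    split_ifs with he <;> simp [he]
  rw [h, measureReal_def, Measure.pi_pi, ENNReal.toReal_prod,
    ← Finset.prod_subset (Finset.subset_univ F)]
  · rw [Finset.prod_congr rfl (g := fun _ => (1 - p : ℝ))]
    · simp
    · intro e he
      simp [he, edgeLaw, hF e he]
  · intro e _ he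
    simp [he]

/-- The pairs of distinct elements of `S`. -/
def spannedPairs {V : Type} [DecidableEq V] (S : Finset V) : Finset (Sym2 V) :=
  S.offDiag.image (fun x => s(x.1, x.2))

theorem mem_spannedPairs {V : Type} [DecidableEq V] {S : Finset V} {u v : V} :
    s(u, v) ∈ spannedPairs S ↔ u ∈ S ∧ v ∈ S ∧ u ≠ v := by
  simp only [spannedPairs, Finset.mem_image, Finset.mem_offDiag, Prod.exists, Sym2.eq_iff]
  constructor
  · rintro ⟨a, b, ⟨ha, hb, hab⟩, ⟨rfl, rfl⟩ | ⟨rfl, rfl⟩⟩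
    · exact ⟨ha, hb, hab⟩
    · exact ⟨hb, ha, hab.symm⟩
  · rintro ⟨hu, hv, huv⟩
    exact ⟨u, v, ⟨hu, hv, huv⟩, Or.inl ⟨rfl, rfl⟩⟩

theorem card_spannedPairs {V : Type} [DecidableEq V] (S : Finset V) :
    (spannedPairs S).card = S.card.choose 2 :=
  Sym2.card_image_offDiag S

theorem spannedPairs_inter {V : Type} [DecidableEq V] (S T : Finset V) :
    spannedPairs S ∩ spannedPairs T = spannedPairs (S ∩ T) := by
  ext e
  induction e with
  | _ u v => simp only [Finset.mem_inter, mem_spannedPairs]; tauto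

theorem spansNoEdge_iff {V : Type} [DecidableEq V] {ω : Sym2 V → Prop} {S : Finset V} :
    SpansNoEdge ω S ↔ ∀ e ∈ spannedPairs S, ¬ ω e := by
  constructor
  · intro h e
    induction e with
    | _ u v =>
      intro he
      obtain ⟨hu, hv, huv⟩ := mem_spannedPairs.1 he
      exact h u hu v hv huv
  · intro h u hu v hv huv
    exact h _ (mem_spannedPairs.2 ⟨hu, hv, huv⟩)

theorem not_isDiag_of_mem_spannedPairs {V : Type} [DecidableEq V] {S : Finset V} {e : Sym2 V}
    (he : e ∈ spannedPairs S) : ¬ e.IsDiag := by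
  induction e with
  | _ u v => simpa using (mem_spannedPairs.1 he).2.2

theorem pi_edgeLaw_real_spansNoEdge {V : Type} [Fintype V] (p : unitInterval) (S : Finset V) :
    (Measure.pi (edgeLaw V p)).real {ω | SpansNoEdge ω S} = (1 - p : ℝ) ^ S.card.choose 2 := by
  classical
  simp_rw [spansNoEdge_iff]
  rw [pi_edgeLaw_real_forall_not p _ fun e he => not_isDiag_of_mem_spannedPairs he,
    card_spannedPairs]

theorem pi_edgeLaw_real_spansNoEdge_and {V : Type} [Fintype V] [DecidableEq V]
    (p : unitInterval) (hp : (p : ℝ) < 1) (S T : Finset V) :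
    (Measure.pi (edgeLaw V p)).real {ω | SpansNoEdge ω S ∧ SpansNoEdge ω T}
      = (1 - p : ℝ) ^ S.card.choose 2 * (1 - p : ℝ) ^ T.card.choose 2 *
        (1 / (1 - p : ℝ)) ^ (S ∩ T).card.choose 2 := by
  have hq : (1 - p : ℝ) ≠ 0 := by linarith
  have h : {ω : Sym2 V → Prop | SpansNoEdge ω S ∧ SpansNoEdge ω T}
      = {ω | ∀ e ∈ spannedPairs S ∪ spannedPairs T, ¬ ω e} := by
    ext ω
    simp only [Set.mem_ofPred_eq, spansNoEdge_iff, Finset.mem_union]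
    constructor
    · rintro ⟨h1, h2⟩ e (he | he)
      · exact h1 e he
      · exact h2 e he
    · intro h
      exact ⟨fun e he => h e (Or.inl he), fun e he => h e (Or.inr he)⟩
  rw [h, pi_edgeLaw_real_forall_not p]
  · have := Finset.card_union_add_card_inter (spannedPairs S) (spannedPairs T)
    rw [spannedPairs_inter, card_spannedPairs, card_spannedPairs, card_spannedPairs] at this
    rw [← pow_add, ← this, pow_add, one_div, inv_pow, mul_assoc,
      mul_inv_cancel₀ (pow_ne_zero _ hq), mul_one]
  · intro e he
    rcases Finset.mem_union.1 he with he | he <;> exact not_isDiag_of_mem_spannedPairs he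

/-- The second moment method, for the number of members of a finite family of `k`-sets that are
independent: `∑ j, q⁻¹ ^ (|S i ∩ S j| choose 2)` compares the second moment with the square of the
first one. -/
theorem inv_le_pi_edgeLaw_real_exists {V κ : Type} [Fintype V] [DecidableEq V]
    (p : unitInterval) (hp : (p : ℝ) < 1) (I : Finset κ) (hI : I.Nonempty) (S : κ → Finset V)
    (k : ℕ) (hS : ∀ i ∈ I, (S i).card = k) (R : ℝ) (hR : 0 < R)
    (h : ∀ i ∈ I, ∑ j ∈ I, (1 / (1 - p : ℝ)) ^ (S i ∩ S j).card.choose 2 ≤ R * I.card) :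
    R⁻¹ ≤ (Measure.pi (edgeLaw V p)).real {ω | ∃ i ∈ I, SpansNoEdge ω (S i)} := by
  classical
  set P := Measure.pi (edgeLaw V p) with hP
  set q : ℝ := (1 - p : ℝ) ^ k.choose 2 with hq
  have hq0 : 0 < q := pow_pos (by linarith) _
  have hc0 : (0 : ℝ) < I.card := by exact_mod_cast hI.card_pos
  let E : κ → (Sym2 V → Prop) → ℝ := fun i => Set.indicator {ω | SpansNoEdge ω (S i)} 1
  let Y : (Sym2 V → Prop) → ℝ := fun ω => ∑ i ∈ I, E i ω
  let B : (Sym2 V → Prop) → ℝ := Set.indicator {ω | ∃ i ∈ I, SpansNoEdge ω (S i)} 1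
  have hYB : ∀ ω, Y ω * B ω = Y ω := by
    intro ω
    by_cases hω : ∃ i ∈ I, SpansNoEdge ω (S i)
    · simp [B, hω]
    · have : Y ω = 0 := by
        apply Finset.sum_eq_zero
        intro i hi
        simp only [E, Set.indicator, Set.mem_ofPred_eq]
        rw [if_neg fun h => hω ⟨i, hi, h⟩]
      simp [this]
  have hBB : ∀ ω, B ω * B ω = B ω := by
    intro ω
    by_cases hω : ∃ i ∈ I, SpansNoEdge ω (S i) <;> simp [B, hω]
  have hEY : ∫ ω, Y ω ∂P = I.card * q := by
    simp only [Y]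
    rw [integral_finsetSum _ fun i _ => Integrable.of_finite]
    rw [Finset.sum_congr rfl (g := fun _ => q)]
    · simp
    · intro i hi
      simp only [E]
      rw [integral_indicator_one (Set.toFinite _).measurableSet, pi_edgeLaw_real_spansNoEdge,
        hS i hi]
  have hEYY : ∫ ω, Y ω * Y ω ∂P ≤ R * (I.card * q) ^ 2 := by
    have h1 : ∀ ω, Y ω * Y ω = ∑ i ∈ I, ∑ j ∈ I,
        Set.indicator {ω | SpansNoEdge ω (S i) ∧ SpansNoEdge ω (S j)} (1 : (Sym2 V → Prop) → ℝ) ω := by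
      intro ω
      simp only [Y, Finset.sum_mul_sum]
      refine Finset.sum_congr rfl fun i _ => Finset.sum_congr rfl fun j _ => ?_
      by_cases hi : SpansNoEdge ω (S i) <;> by_cases hj : SpansNoEdge ω (S j) <;>
        simp [E, Set.indicator, hi, hj]
    simp_rw [h1]
    rw [integral_finsetSum _ fun i _ => Integrable.of_finite]
    calc _ ≤ ∑ i ∈ I, q * q * (R * I.card) := by
          refine Finset.sum_le_sum fun i hi => ?_
          rw [integral_finsetSum _ fun i _ => Integrable.of_finite]
          refine le_trans (le_of_eq ?_) (mul_le_mul_of_nonneg_left (h i hi) (by positivity))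
          rw [Finset.mul_sum]
          refine Finset.sum_congr rfl fun j hj => ?_
          rw [integral_indicator_one (Set.toFinite _).measurableSet,
            pi_edgeLaw_real_spansNoEdge_and p hp, hS i hi, hS j hj]
      _ = _ := by rw [Finset.sum_const, nsmul_eq_mul]; ring
  have hEB : ∫ ω, B ω ∂P = P.real {ω | ∃ i ∈ I, SpansNoEdge ω (S i)} :=
    integral_indicator_one (Set.toFinite _).measurableSet
  -- The square of `t Y - B` has nonnegative mean; this `t` is the optimal one.
  set t : ℝ := (R * (I.card * q))⁻¹ with ht
  have hsq : 0 ≤ ∫ ω, (t * Y ω - B ω) ^ 2 ∂P := integral_nonneg fun ω => sq_nonneg _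
  have hexp : ∫ ω, (t * Y ω - B ω) ^ 2 ∂P
      = t ^ 2 * ∫ ω, Y ω * Y ω ∂P - 2 * t * ∫ ω, Y ω ∂P + ∫ ω, B ω ∂P := by
    rw [← integral_const_mul, ← integral_const_mul,
      ← integral_sub Integrable.of_finite Integrable.of_finite,
      ← integral_add Integrable.of_finite Integrable.of_finite]
    congr 1; ext ω
    linear_combination hBB ω - 2 * t * hYB ω
  rw [hexp, hEY, hEB] at hsq
  have h2 : t ^ 2 * ∫ ω, Y ω * Y ω ∂P ≤ t ^ 2 * (R * (I.card * q) ^ 2) :=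
    mul_le_mul_of_nonneg_left hEYY (sq_nonneg _)
  have h3 : t ^ 2 * (R * (I.card * q) ^ 2) = R⁻¹ := by
    rw [ht]; field_simp
  have h4 : 2 * t * (I.card * q) = 2 * R⁻¹ := by
    rw [ht]; field_simp
  linarith

/-! ### Transversals of blocks and their overlaps -/

theorem card_filter_subset_powersetCard {β : Type} [Fintype β] [DecidableEq β] (R : Finset β)
    (k : ℕ) (hk : R.card ≤ k) :
    ((Finset.powersetCard k Finset.univ).filter (R ⊆ ·)).card
      = (Fintype.card β - R.card).choose (k - R.card) := by
  rw [← Finset.card_univ, ← Finset.card_sdiff_of_subset (Finset.subset_univ R),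
    ← Finset.card_powersetCard]
  refine Finset.card_nbij' (· \ R) (· ∪ R) ?_ ?_ ?_ ?_
  · intro B hB
    simp only [Finset.coe_filter, Finset.mem_powersetCard, Finset.subset_univ, true_and,
      Set.mem_ofPred_eq] at hB
    simp only [Finset.mem_coe, Finset.mem_powersetCard]
    exact ⟨Finset.sdiff_subset_sdiff (Finset.subset_univ _) le_rfl, by
      rw [Finset.card_sdiff_of_subset hB.2, hB.1]⟩
  · intro B hB
    simp only [Finset.mem_coe, Finset.mem_powersetCard] at hB
    simp only [Finset.coe_filter, Finset.mem_powersetCard, Finset.subset_univ, true_and,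
      Set.mem_ofPred_eq]
    have hd : Disjoint B R := Finset.disjoint_of_subset_left hB.1 Finset.sdiff_disjoint
    refine ⟨?_, Finset.subset_union_right⟩
    rw [Finset.card_union_of_disjoint hd, hB.2]
    omega
  · intro B hB
    simp only [Finset.coe_filter, Set.mem_ofPred_eq] at hB
    exact Finset.sdiff_union_of_subset hB.2
  · intro B hB
    simp only [Finset.mem_coe, Finset.mem_powersetCard] at hB
    exact Finset.union_sdiff_cancel_right
      (Finset.disjoint_of_subset_left hB.1 Finset.sdiff_disjoint)

theorem card_filter_eqOn {N m : ℕ} (R : Finset (Fin N)) (g : Fin N → Fin m) :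
    ((Finset.univ : Finset (Fin N → Fin m)).filter (fun g' => ∀ b ∈ R, g b = g' b)).card
      = m ^ (N - R.card) := by
  have h : (Finset.univ : Finset (Fin N → Fin m)).filter (fun g' => ∀ b ∈ R, g b = g' b)
      = Fintype.piFinset fun b => if b ∈ R then {g b} else Finset.univ := by
    ext g'
    simp only [Finset.mem_filter, Finset.mem_univ, true_and, Fintype.mem_piFinset]
    refine forall_congr' fun b => ?_
    split_ifs with hb <;> simp [hb, eq_comm]
  rw [h, Fintype.card_piFinset]
  calc _ = ∏ b : Fin N, if b ∈ R then 1 else m := by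
        refine Finset.prod_congr rfl fun b _ => ?_
        split_ifs <;> simp
    _ = m ^ (N - R.card) := by
        rw [Finset.prod_ite]
        simp [Finset.filter_not, Finset.card_sdiff]

/-- Codes for the vertex sets with at most one vertex in each of `N` blocks of size `m`: a set
of `k` blocks, and a choice of a vertex in every block. Each vertex set has `m ^ (N - k)` codes. -/
def transversals (N m k : ℕ) : Finset (Finset (Fin N) × (Fin N → Fin m)) :=
  Finset.powersetCard k Finset.univ ×ˢ Finset.univ

theorem card_transversals (N m k : ℕ) : (transversals N m k).card = N.choose k * m ^ N := by
  simp [transversals]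

/-- The blocks in which the vertex sets coded by `i` and `j` have a common vertex. -/
def agreement {N m : ℕ} (i j : Finset (Fin N) × (Fin N → Fin m)) : Finset (Fin N) :=
  (i.1 ∩ j.1).filter fun b => i.2 b = j.2 b

theorem card_filter_subset_agreement {N m k : ℕ} (i : Finset (Fin N) × (Fin N → Fin m))
    (R : Finset (Fin N)) (hR : R ⊆ i.1) (hk : R.card ≤ k) :
    ((transversals N m k).filter (fun j => R ⊆ agreement i j)).card
      = (N - R.card).choose (k - R.card) * m ^ (N - R.card) := by
  have h := card_filter_subset_powersetCard R k hk
  rw [Fintype.card_fin] at h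
  rw [← h, ← card_filter_eqOn R i.2, ← Finset.card_product]
  congr 1
  ext j
  simp only [transversals, agreement, Finset.mem_filter, Finset.mem_product, Finset.mem_univ,
    and_true, true_and, Finset.subset_iff, Finset.mem_inter]
  constructor
  · rintro ⟨h1, h2⟩
    exact ⟨⟨h1, fun b hb => (h2 hb).1.2⟩, fun b hb => (h2 hb).2⟩
  · rintro ⟨⟨h1, h2⟩, h3⟩
    exact ⟨h1, fun b hb => ⟨⟨hR hb, h2 hb⟩, h3 b hb⟩⟩

theorem choose_sub_mul_pow_le (N k r : ℕ) (hk : k ≤ N) (hr : r ≤ k) :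
    ((N - r).choose (k - r) : ℝ) * N ^ r ≤ N.choose k * k ^ r := by
  induction r with
  | zero => simp
  | succ r ih =>
    have h1 := ih (by omega)
    have h2 := Nat.add_one_mul_choose_eq (N - (r + 1)) (k - (r + 1))
    have e1 : N - (r + 1) + 1 = N - r := by omega
    have e2 : k - (r + 1) + 1 = k - r := by omega
    rw [e1, e2] at h2
    have h2' : ((N : ℝ) - r) * ((N - (r + 1)).choose (k - (r + 1)) : ℝ)
        = (N - r).choose (k - r) * ((k : ℝ) - r) := by
      rw [← Nat.cast_sub (by omega), ← Nat.cast_sub (by omega)]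
      exact_mod_cast h2
    have hrN : (0 : ℝ) < (N : ℝ) - r := by
      have : (r : ℝ) + 1 ≤ N := by exact_mod_cast hr.trans hk
      linarith
    have hkN : (k : ℝ) ≤ N := by exact_mod_cast hk
    have hrk : (0 : ℝ) ≤ (k : ℝ) - r := by
      have : (r : ℝ) + 1 ≤ k := by exact_mod_cast hr
      linarith
    have h3 : (N : ℝ) * ((N - (r + 1)).choose (k - (r + 1)) : ℝ)
        ≤ k * (N - r).choose (k - r) := by
      set u : ℝ := ((N - (r + 1)).choose (k - (r + 1)) : ℝ)
      set v : ℝ := ((N - r).choose (k - r) : ℝ)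
      have hv : 0 ≤ v := Nat.cast_nonneg _
      have : u = v * (k - r) / (N - r) := by
        rw [eq_div_iff hrN.ne']; linarith
      rw [this, ← mul_div_assoc, div_le_iff₀ hrN]
      nlinarith [mul_nonneg (mul_nonneg hv (sub_nonneg.2 hkN)) (Nat.cast_nonneg (α := ℝ) r)]
    calc _ = (N * ((N - (r + 1)).choose (k - (r + 1)) : ℝ)) * N ^ r := by ring
      _ ≤ (k * (N - r).choose (k - r)) * N ^ r := by gcongr
      _ = k * ((N - r).choose (k - r) * N ^ r) := by ring
      _ ≤ k * (N.choose k * k ^ r) := by gcongr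
      _ = _ := by ring

/-- The generating function of the size of the overlap of a fixed transversal with a random one
is at most that of a Poisson variable of mean `k ^ 2 / (N * m)`. -/
theorem sum_pow_card_agreement_le {N m k : ℕ} (hk : k ≤ N) (hm : 0 < m) (hN : 0 < N)
    {i : Finset (Fin N) × (Fin N → Fin m)} (hi : i ∈ transversals N m k) {z : ℝ} (hz : 1 ≤ z) :
    ∑ j ∈ transversals N m k, z ^ (agreement i j).card
      ≤ (transversals N m k).card * Real.exp ((z - 1) * k ^ 2 / (N * m)) := by
  have hi' : i.1.card = k := by
    simpa [transversals] using hi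
  have hm' : (0 : ℝ) < m := by exact_mod_cast hm
  have hN' : (0 : ℝ) < N := by exact_mod_cast hN
  set w : ℝ := (z - 1) * (k / (N * m)) with hw
  have hz' : 0 ≤ z - 1 := by linarith
  have hw0 : 0 ≤ w := by positivity
  calc ∑ j ∈ transversals N m k, z ^ (agreement i j).card
      = ∑ j ∈ transversals N m k, ∑ R ∈ i.1.powerset,
          if R ⊆ agreement i j then (z - 1) ^ R.card else 0 := by
        refine Finset.sum_congr rfl fun j _ => ?_
        have hsub : agreement i j ⊆ i.1 :=
          (Finset.filter_subset _ _).trans Finset.inter_subset_left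
        rw [← Finset.sum_filter]
        have : i.1.powerset.filter (· ⊆ agreement i j) = (agreement i j).powerset := by
          ext R
          simp only [Finset.mem_filter, Finset.mem_powerset]
          exact ⟨fun h => h.2, fun h => ⟨h.trans hsub, h⟩⟩
        rw [this]
        have := Finset.sum_pow_mul_eq_add_pow (z - 1) 1 (agreement i j)
        simpa using this.symm
    _ = ∑ R ∈ i.1.powerset, (z - 1) ^ R.card *
          ((N - R.card).choose (k - R.card) * m ^ (N - R.card) : ℕ) := by
        rw [Finset.sum_comm]
        refine Finset.sum_congr rfl fun R hR => ?_
        have hR' := Finset.mem_powerset.1 hR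
        rw [← card_filter_subset_agreement i R hR' (hi' ▸ Finset.card_le_card hR'),
          ← Finset.sum_filter, Finset.sum_const, nsmul_eq_mul, mul_comm]
    _ ≤ ∑ R ∈ i.1.powerset, (transversals N m k).card * w ^ R.card := by
        refine Finset.sum_le_sum fun R hR => ?_
        have hR' : R.card ≤ k := hi' ▸ Finset.card_le_card (Finset.mem_powerset.1 hR)
        rw [card_transversals, hw, mul_pow, ← mul_assoc, mul_comm _ ((z - 1) ^ R.card), mul_assoc]
        refine mul_le_mul_of_nonneg_left ?_ (pow_nonneg hz' _)
        have h1 := choose_sub_mul_pow_le N k R.card hk hR'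
        rw [div_pow, ← mul_div_assoc, le_div_iff₀ (by positivity)]
        push_cast
        have h2 : (m : ℝ) ^ N = m ^ (N - R.card) * m ^ R.card := by
          rw [← pow_add]; congr 1; omega
        rw [h2, mul_pow]
        calc _ = (((N - R.card).choose (k - R.card) : ℝ) * N ^ R.card) *
              (m ^ (N - R.card) * m ^ R.card) := by ring
          _ ≤ (N.choose k * k ^ R.card) * (m ^ (N - R.card) * m ^ R.card) := by gcongr
          _ = _ := by ring
    _ = (transversals N m k).card * (w + 1) ^ k := by
        rw [← Finset.mul_sum, ← hi', ← Finset.sum_pow_mul_eq_add_pow]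
        simp
    _ ≤ (transversals N m k).card * Real.exp w ^ k := by
        gcongr
        exact Real.add_one_le_exp w
    _ = _ := by
        rw [← Real.exp_nat_mul, hw]
        congr 2
        ring

/-- The number of overlaps of size `l`, bounded by the sum over all `l`-sets `R` of blocks of the
number of transversals that agree with the given one on `R`. -/
theorem card_filter_card_agreement_le {N m k : ℕ} (hk : k ≤ N) (l : ℕ) (hl : l ≤ k)
    {i : Finset (Fin N) × (Fin N → Fin m)} (hi : i ∈ transversals N m k) :
    ((transversals N m k).filter (fun j => (agreement i j).card = l)).card *
        (N.choose l * m ^ l) ≤ (transversals N m k).card * k.choose l ^ 2 := by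
  have hi' : i.1.card = k := by
    simpa [transversals] using hi
  have h1 : ((transversals N m k).filter (fun j => (agreement i j).card = l)).card
      ≤ ∑ R ∈ Finset.powersetCard l i.1,
        ((transversals N m k).filter (fun j => R ⊆ agreement i j)).card := by
    refine le_trans (Finset.card_le_card ?_) Finset.card_biUnion_le
    intro j hj
    rw [Finset.mem_filter] at hj
    simp only [Finset.mem_biUnion, Finset.mem_filter]
    exact ⟨agreement i j, Finset.mem_powersetCard.2
      ⟨(Finset.filter_subset _ _).trans Finset.inter_subset_left, hj.2⟩, hj.1, subset_rfl⟩
  rw [Finset.sum_congr rfl (g := fun _ => (N - l).choose (k - l) * m ^ (N - l))] at h1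
  · rw [Finset.sum_const, Finset.card_powersetCard, hi', smul_eq_mul] at h1
    rw [card_transversals]
    have h2 := Nat.choose_mul (n := N) (k := k) (s := l) hl
    have h3 : m ^ N = m ^ (N - l) * m ^ l := by
      rw [← pow_add]; congr 1; omega
    calc _ ≤ (k.choose l * ((N - l).choose (k - l) * m ^ (N - l))) * (N.choose l * m ^ l) := by
          gcongr
      _ = k.choose l * (N.choose l * (N - l).choose (k - l)) * (m ^ (N - l) * m ^ l) := by ring
      _ = _ := by rw [← h2, h3]; ring
  · intro R hR
    obtain ⟨hR1, hR2⟩ := Finset.mem_powersetCard.1 hR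
    rw [card_filter_subset_agreement i R hR1 (hR2 ▸ hl), hR2]

/-- The vertex of index `r` in the block `b`; the blocks are residue classes modulo `N`. -/
def blockVertex {N m n : ℕ} (h : N * m ≤ n) (b : Fin N) (r : Fin m) : Fin n :=
  ⟨b + N * r, by
    have h1 : N * (r + 1) ≤ N * m := Nat.mul_le_mul_left _ r.2
    have h2 := b.2
    rw [Nat.mul_add] at h1
    omega⟩

theorem blockVertex_inj {N m n : ℕ} (h : N * m ≤ n) {b b' : Fin N} {r r' : Fin m} :
    blockVertex h b r = blockVertex h b' r' ↔ b = b' ∧ r = r' := by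
  constructor
  · intro he
    have he' : (b : ℕ) + N * r = b' + N * r' := congrArg Fin.val he
    have h1 := congrArg (· % N) he'
    simp only [Nat.add_mul_mod_self_left, Nat.mod_eq_of_lt b.2, Nat.mod_eq_of_lt b'.2] at h1
    rw [h1] at he'
    have h2 : N * (r : ℕ) = N * r' := by omega
    exact ⟨Fin.ext h1, Fin.ext (Nat.eq_of_mul_eq_mul_left (by have := b.2; omega) h2)⟩
  · rintro ⟨rfl, rfl⟩
    rfl

/-- The vertex set with code `i`. -/
def transversalSet {N m n : ℕ} (h : N * m ≤ n) (i : Finset (Fin N) × (Fin N → Fin m)) :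
    Finset (Fin n) :=
  i.1.image fun b => blockVertex h b (i.2 b)

theorem card_transversalSet {N m n : ℕ} (h : N * m ≤ n)
    (i : Finset (Fin N) × (Fin N → Fin m)) : (transversalSet h i).card = i.1.card :=
  Finset.card_image_of_injective _ fun _ _ hb => ((blockVertex_inj h).1 hb).1

theorem card_transversalSet_inter {N m n : ℕ} (h : N * m ≤ n)
    (i j : Finset (Fin N) × (Fin N → Fin m)) :
    (transversalSet h i ∩ transversalSet h j).card = (agreement i j).card := by
  have : transversalSet h i ∩ transversalSet h j
      = (agreement i j).image fun b => blockVertex h b (i.2 b) := by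
    ext v
    simp only [transversalSet, agreement, Finset.mem_inter, Finset.mem_image, Finset.mem_filter]
    constructor
    · rintro ⟨⟨b, hb, rfl⟩, b', hb', he⟩
      obtain ⟨rfl, h2⟩ := (blockVertex_inj h).1 he
      exact ⟨b', ⟨⟨hb, hb'⟩, h2.symm⟩, rfl⟩
    · rintro ⟨b, ⟨⟨h1, h2⟩, h3⟩, rfl⟩
      exact ⟨⟨b, h1, rfl⟩, b, h2, by rw [h3]⟩
  rw [this]
  exact Finset.card_image_of_injective _ fun _ _ hb => ((blockVertex_inj h).1 hb).1

theorem injOn_mod_transversalSet {N m n : ℕ} (h : N * m ≤ n)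
    (i : Finset (Fin N) × (Fin N → Fin m)) :
    Set.InjOn (fun v : Fin n => (v : ℕ) % N) (transversalSet h i) := by
  intro u hu v hv huv
  simp only [transversalSet, Finset.coe_image, Set.mem_image] at hu hv
  obtain ⟨b, -, rfl⟩ := hu
  obtain ⟨b', -, rfl⟩ := hv
  simp only [blockVertex, Nat.add_mul_mod_self_left, Nat.mod_eq_of_lt b.2,
    Nat.mod_eq_of_lt b'.2] at huv
  rw [Fin.ext huv]

/-! ### Independent transversals and concentration -/

open Classical in
/-- The largest size of a set that spans no edge of `ω` and has at most one vertex in each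
residue class modulo `N`. -/
noncomputable def transversalIndepNum {n : ℕ} (N : ℕ) (ω : Sym2 (Fin n) → Prop) : ℕ :=
  ((Finset.univ : Finset (Finset (Fin n))).filter fun S =>
    SpansNoEdge ω S ∧ Set.InjOn (fun v : Fin n => (v : ℕ) % N) S).sup Finset.card

theorem card_le_transversalIndepNum {n N : ℕ} {ω : Sym2 (Fin n) → Prop} {S : Finset (Fin n)}
    (h : SpansNoEdge ω S) (hS : Set.InjOn (fun v : Fin n => (v : ℕ) % N) S) :
    S.card ≤ transversalIndepNum N ω := by
  classical
  unfold transversalIndepNum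
  exact Finset.le_sup (f := Finset.card) (by simpa using ⟨h, hS⟩)

theorem exists_card_eq_transversalIndepNum {n : ℕ} (N : ℕ) (ω : Sym2 (Fin n) → Prop) :
    ∃ S : Finset (Fin n), SpansNoEdge ω S ∧ Set.InjOn (fun v : Fin n => (v : ℕ) % N) S ∧
      S.card = transversalIndepNum N ω := by
  classical
  unfold transversalIndepNum
  obtain ⟨S, hS, he⟩ := Finset.exists_mem_eq_sup
    ((Finset.univ : Finset (Finset (Fin n))).filter fun S =>
    SpansNoEdge ω S ∧ Set.InjOn (fun v : Fin n => (v : ℕ) % N) S)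
    ⟨∅, Finset.mem_filter.2 ⟨Finset.mem_univ _, by simp [SpansNoEdge], by simp⟩⟩ Finset.card
  simp only [Finset.mem_filter, Finset.mem_univ, true_and] at hS
  exact ⟨S, hS.1, hS.2, he.symm⟩

/-- The smaller of the blocks of the two ends of an edge. Exposing the edges by the value of this
function splits the random graph into `N` independent parts. -/
def edgeBlock {n : ℕ} (N : ℕ) : Sym2 (Fin n) → ℕ :=
  Sym2.lift ⟨fun u v => min ((u : ℕ) % N) ((v : ℕ) % N), fun _ _ => min_comm _ _⟩

theorem edgeBlock_lt {n N : ℕ} (hN : 0 < N) (e : Sym2 (Fin n)) : edgeBlock N e < N := by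
  induction e with
  | _ u v => exact (min_le_left _ _).trans_lt (Nat.mod_lt _ hN)

theorem transversalIndepNum_le_add_one {n : ℕ} (N k : ℕ) (ω ω' : Sym2 (Fin n) → Prop)
    (h : ∀ e, edgeBlock N e ≠ k → ω e = ω' e) :
    transversalIndepNum N ω ≤ transversalIndepNum N ω' + 1 := by
  classical
  obtain ⟨S, hS, hinj, hcard⟩ := exists_card_eq_transversalIndepNum N ω
  rw [← hcard]
  have h1 : (S.filter fun v : Fin n => (v : ℕ) % N = k).card ≤ 1 := by
    rw [Finset.card_le_one]
    intro a ha b hb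
    rw [Finset.mem_filter] at ha hb
    exact hinj ha.1 hb.1 (ha.2.trans hb.2.symm)
  have h2 : (S.filter fun v : Fin n => ¬ (v : ℕ) % N = k).card ≤ transversalIndepNum N ω' := by
    apply card_le_transversalIndepNum
    · intro u hu v hv huv
      rw [Finset.mem_filter] at hu hv
      rw [← h]
      · exact hS u hu.1 v hv.1 huv
      · show min ((u : ℕ) % N) ((v : ℕ) % N) ≠ k
        rcases min_choice ((u : ℕ) % N) ((v : ℕ) % N) with he | he <;> rw [he]
        · exact hu.2
        · exact hv.2
    · exact hinj.mono (by
        intro v hv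
        exact (Finset.mem_filter.1 hv).1)
  have h3 := S.card_filter_add_card_filter_not (fun v : Fin n => (v : ℕ) % N = k)
  omega

theorem abs_transversalIndepNum_sub_le {n : ℕ} (N k : ℕ) (ω ω' : Sym2 (Fin n) → Prop)
    (h : ∀ e, edgeBlock N e ≠ k → ω e = ω' e) :
    |(transversalIndepNum N ω : ℝ) - transversalIndepNum N ω'| ≤ 1 := by
  have h1 : (transversalIndepNum N ω : ℝ) ≤ transversalIndepNum N ω' + 1 := by
    exact_mod_cast transversalIndepNum_le_add_one N k ω ω' h
  have h2 : (transversalIndepNum N ω' : ℝ) ≤ transversalIndepNum N ω + 1 := by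
    exact_mod_cast transversalIndepNum_le_add_one N k ω' ω fun e he => (h e he).symm
  exact abs_le.2 ⟨by linarith, by linarith⟩

theorem spansNoEdge_mono {V : Type} {ω : Sym2 V → Prop} {S T : Finset V} (hST : S ⊆ T)
    (h : SpansNoEdge ω T) : SpansNoEdge ω S :=
  fun u hu v hv => h u (hST hu) v (hST hv)

theorem probIndep_eq_pi (c α : ℝ) (n : ℕ) :
    probIndep c α n = (Measure.pi (edgeLaw (Fin n) (edgeProb c n))).real
      {ω | ∃ S : Finset (Fin n), SpansNoEdge ω S ∧ S.card = ⌈α * n⌉₊} := by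
  unfold probIndep
  rw [binomialRandom_real_eq_pi]
  congr 1
  ext ω
  simp only [Set.mem_ofPred_eq, SimpleGraph.isNIndepSet_iff, isIndepSet_fromEdgeSet_iff]

/-- If independent transversals of size `k` have a probability that beats the deviation
inequality for deviation `s`, then independent sets of size `k - 2 * s` exist with high
probability. -/
theorem one_sub_exp_le_probIndep {c α s : ℝ} {n N m k : ℕ} (hN : 0 < N) (h : N * m ≤ n)
    (hs : 0 ≤ s) (hα : (⌈α * n⌉₊ : ℝ) ≤ k - 2 * s)
    (hk : Real.exp (-(2 * s ^ 2 / N)) < (Measure.pi (edgeLaw (Fin n) (edgeProb c n))).real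
      {ω | ∃ i ∈ transversals N m k, SpansNoEdge ω (transversalSet h i)}) :
    1 - Real.exp (-(2 * s ^ 2 / N)) ≤ probIndep c α n := by
  set P := Measure.pi (edgeLaw (Fin n) (edgeProb c n)) with hP
  have h1 := measureReal_le_sub_of_bounded_diff (X := Prop) hN (edgeLaw (Fin n) (edgeProb c n))
    (edgeBlock N) (edgeBlock_lt hN) (fun ω => (transversalIndepNum N ω : ℝ))
    (abs_transversalIndepNum_sub_le N) (K := k) hs (hk.trans_le (measureReal_mono (by
      rintro ω ⟨i, hi, hω⟩
      simp only [Set.mem_ofPred_eq, Nat.cast_le]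
      have hi' : i.1.card = k := by simpa [transversals] using hi
      rw [← hi', ← card_transversalSet h i]
      exact card_le_transversalIndepNum hω (injOn_mod_transversalSet h i))))
  rw [probIndep_eq_pi]
  have h2 := probReal_compl_eq_one_sub (μ := P)
    (s := {ω | (transversalIndepNum N ω : ℝ) ≤ k - 2 * s}) (Set.toFinite _).measurableSet
  have h3 : P.real {ω | (transversalIndepNum N ω : ℝ) ≤ k - 2 * s}ᶜ
      ≤ P.real {ω | ∃ S : Finset (Fin n), SpansNoEdge ω S ∧ S.card = ⌈α * n⌉₊} := by
    refine measureReal_mono ?_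
    intro ω hω
    simp only [Set.mem_compl_iff, Set.mem_ofPred_eq, not_le] at hω
    obtain ⟨S, hS, -, hcard⟩ := exists_card_eq_transversalIndepNum N ω
    have : ⌈α * n⌉₊ ≤ S.card := by
      rw [hcard]
      exact_mod_cast hα.trans hω.le
    obtain ⟨T, hT, hTc⟩ := Finset.exists_subset_card_eq this
    exact ⟨T, spansNoEdge_mono hT hS, hTc⟩
  linarith

/-! ### The exponents of the overlaps -/

/-- The exponent of overlaps `x = α - y` close to `α`, after rescaling `y = r ^ 3 * h` and dividing
by `r ^ 3`. The dominant terms are `-v - 2 * h * log h`; their sum is negative for `v > 2 / e`,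
because the maximum of `-h * log h` is `1 / e`. -/
theorem scaled_overlap_exponent_nonpos {W r v m ε h : ℝ} (hv : 0 < v) (hW : 8 + v ≤ W)
    (hr : 0 < r) (hlog : 2 * Real.log r = 1 - W)
    (hmain : 2 / Real.exp 1 + 8 * v * r + 16 * r * (W + 2) + 2 * m * r ≤ v * (1 - ε))
    (hh0 : 0 ≤ h) (hH : h ≤ 1 / (2 * r)) :
    -(v * (1 - ε)) + h * (2 * (v * r) - 2 * Real.log h) + r * h ^ 2 * (W + 2) + 2 * m * r
      ≤ 0 := by
  have hW0 : 0 < W := by linarith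
  rcases le_total h 4 with h4 | h4
  · have hle : -(h * Real.log h) ≤ 1 / Real.exp 1 := by
      rcases hh0.eq_or_lt with h0 | h0
      · rw [← h0]; simp; positivity
      · have := Real.log_le_sub_one_of_pos
          (show 0 < 1 / (Real.exp 1 * h) by positivity)
        rw [one_div, Real.log_inv, Real.log_mul (Real.exp_pos 1).ne' h0.ne', Real.log_exp] at this
        have h3 : h * (Real.exp 1 * h)⁻¹ = 1 / Real.exp 1 := by field_simp
        rw [← h3, ← mul_neg]
        exact mul_le_mul_of_nonneg_left (by linarith) hh0
    have h5 : h * (2 * (v * r)) ≤ 8 * v * r := by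
      have : 0 ≤ v * r := by positivity
      have := mul_le_mul_of_nonneg_right h4 this
      linarith
    have h6 : r * h ^ 2 * (W + 2) ≤ 16 * r * (W + 2) := by
      have : h ^ 2 ≤ 16 := by nlinarith
      have : r * (W + 2) * h ^ 2 ≤ r * (W + 2) * 16 := by gcongr
      linarith
    have h7 : 2 / Real.exp 1 = 2 * (1 / Real.exp 1) := by ring
    linarith
  · -- Since `log h / h` decreases for `h ≥ e`, it is at least its value at `1 / (2 * r)`.
    have he4 : Real.exp 1 ≤ 4 := by linarith [Real.exp_one_lt_d9]
    have hanti := Real.log_div_self_antitoneOn (he4.trans h4) (he4.trans (h4.trans hH)) hH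
    have hlogH : Real.log (1 / (2 * r)) = (W - 1) / 2 - Real.log 2 := by
      rw [one_div, Real.log_inv, Real.log_mul two_ne_zero hr.ne']; linarith
    simp only [hlogH] at hanti
    have hl : r * h * (W - 1 - 2 * Real.log 2) ≤ Real.log h := by
      have h0 : 0 < h := by linarith
      rw [le_div_iff₀ h0] at hanti
      refine le_trans (le_of_eq ?_) hanti
      field_simp
    have hlog2 := Real.log_two_lt_d9
    have hpos : 0 ≤ W - 4 - 4 * Real.log 2 := by linarith
    have h8 : r * 4 * (W - 4 - 4 * Real.log 2) ≤ r * h * (W - 4 - 4 * Real.log 2) := by gcongr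
    have h9 : 2 * (v * r) ≤ r * 4 * (W - 4 - 4 * Real.log 2) := by
      have := mul_le_mul_of_nonneg_left
        (show 2 * v ≤ 4 * (W - 4 - 4 * Real.log 2) by linarith) hr.le
      linarith
    have h10 : 2 * (v * r) - 2 * Real.log h + r * h * (W + 2) ≤ 0 := by linarith
    have h11 : h * (2 * (v * r) - 2 * Real.log h + r * h * (W + 2)) ≤ 0 :=
      mul_nonpos_of_nonneg_of_nonpos hh0 h10
    have h12 : 0 ≤ 2 / Real.exp 1 + 8 * v * r + 16 * r * (W + 2) := by positivity
    linarith

/-- The union bound makes overlaps `x ≥ α / 2` negligible if `α` lies below the root `r ^ 2` of the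
first moment exponent by at least `(2 / e) * r ^ 3 / W`, up to lower order terms. -/
theorem overlap_exponent_large_nonpos {W r v m x y α c : ℝ} (hv : 0 < v) (hW : 8 + v ≤ W)
    (hr : 0 < r) (hlog : 2 * Real.log r = 1 - W) (hm : 0 ≤ m) (hα : α = r ^ 2 * (1 - v * r / W))
    (hc : c = 2 * W / r ^ 2) (hvr : v * r / W ≤ 1 / 2)
    (hmain : 2 / Real.exp 1 + 8 * v * r + 16 * r * (W + 2) + 2 * m * r ≤ v * (1 - v * r / W))
    (hy : 0 ≤ y) (hyα : y ≤ α / 2) (hx : x = α - y) :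
    2 * (y * (1 + Real.log (α / y))) - x * (1 - Real.log x) + 2 * m * x ^ 2 + c * x ^ 2 / 2
      ≤ 0 := by
  have hW0 : 0 < W := by linarith
  set ε := v * r / W with hε
  have hε0 : 0 < ε := by positivity
  have hWε : W * ε = v * r := by rw [hε]; field_simp
  have h1ε : 0 < 1 - ε := by linarith
  have hα0 : 0 < α := by rw [hα]; positivity
  have hαr : α ≤ r ^ 2 := by rw [hα]; nlinarith [sq_nonneg r]
  have hαr' : r ^ 2 / 2 ≤ α := by rw [hα]; nlinarith [sq_nonneg r]
  have hx0 : 0 < x := by linarith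
  have hxα : x ≤ α := by linarith
  have hlogα : Real.log α = 1 - W + Real.log (1 - ε) := by
    rw [hα, Real.log_mul (by positivity) h1ε.ne', Real.log_pow]
    push_cast; linarith
  have hlogε : Real.log (1 - ε) ≤ -ε := by
    have := Real.log_le_sub_one_of_pos h1ε; linarith
  have hcα : c * α = 2 * W * (1 - ε) := by
    rw [hc, hα]; field_simp
  -- Expand the first moment exponent at `x` around `α`.
  have hlogx : Real.log x ≤ Real.log α - y / α := by
    have := Real.log_le_sub_one_of_pos (div_pos hx0 hα0)
    rw [Real.log_div hx0.ne' hα0.ne'] at this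
    have h2 : x / α = 1 - y / α := by rw [hx]; field_simp
    linarith
  have hF1 : x * (1 - Real.log α) + y - y ^ 2 / α ≤ x * (1 - Real.log x) := by
    have h2 : x * (y / α) = y - y ^ 2 / α := by rw [hx]; field_simp
    have h3 := mul_le_mul_of_nonneg_left
      (show 1 - Real.log α + y / α ≤ 1 - Real.log x by linarith) hx0.le
    linarith
  have hF2 : r ^ 3 * (v * (1 - ε)) ≤ α * (1 - Real.log α) - c * α ^ 2 / 2 := by
    have : α * (1 - Real.log α) - c * α ^ 2 / 2 = α * (1 - Real.log α - (c * α) / 2) := by ring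
    rw [this, hcα, hlogα]
    have h2 : v * r ≤ 1 - (1 - W + Real.log (1 - ε)) - 2 * W * (1 - ε) / 2 := by linarith
    calc r ^ 3 * (v * (1 - ε)) = α * (v * r) := by rw [hα]; ring
      _ ≤ _ := mul_le_mul_of_nonneg_left h2 hα0.le
  have hbr : 2 + Real.log α - c * α ≤ 6 * Real.log r + 2 * (v * r) := by
    rw [hcα, hlogα]; linarith
  obtain ⟨h, hh⟩ : ∃ h, h = y / r ^ 3 := ⟨_, rfl⟩
  have hyh : y = r ^ 3 * h := by rw [hh]; field_simp
  have hh0 : 0 ≤ h := by rw [hh]; positivity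
  have hquad : y ^ 2 * (1 / α + c / 2) ≤ r ^ 3 * (r * h ^ 2 * (W + 2)) := by
    have h1 : 1 / α ≤ 2 / r ^ 2 := by
      rw [div_le_div_iff₀ hα0 (by positivity)]; linarith
    calc y ^ 2 * (1 / α + c / 2) ≤ y ^ 2 * (2 / r ^ 2 + c / 2) := by gcongr
      _ = _ := by rw [hyh, hc]; field_simp; ring
  have hmα : 2 * m * x ^ 2 ≤ r ^ 3 * (2 * m * r) := by
    calc 2 * m * x ^ 2 ≤ 2 * m * (r ^ 2) ^ 2 := by gcongr; exact hxα.trans hαr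
      _ = _ := by ring
  have hlin : y * (2 + Real.log α - c * α - 2 * Real.log y)
      ≤ r ^ 3 * (h * (2 * (v * r) - 2 * Real.log h)) := by
    rcases hh0.eq_or_lt with h0 | h0
    · rw [hyh, ← h0]; simp
    · have : Real.log y = 3 * Real.log r + Real.log h := by
        rw [hyh, Real.log_mul (by positivity) h0.ne', Real.log_pow]; norm_num
      calc _ ≤ y * (2 * (v * r) - 2 * Real.log h) := by
            apply mul_le_mul_of_nonneg_left _ hy; linarith
        _ = _ := by rw [hyh]; ring
  have hyl : y * (1 + Real.log (α / y)) = y * (1 + Real.log α - Real.log y) := by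
    rcases hy.eq_or_lt with h0 | h0
    · rw [← h0]; simp
    · rw [Real.log_div hα0.ne' h0.ne']; ring
  have htot : 2 * (y * (1 + Real.log (α / y))) - x * (1 - Real.log x) + 2 * m * x ^ 2
      + c * x ^ 2 / 2 ≤ r ^ 3 * (-(v * (1 - ε)) + h * (2 * (v * r) - 2 * Real.log h)
        + r * h ^ 2 * (W + 2) + 2 * m * r) := by
    rw [hyl]
    have e1 : c * x ^ 2 / 2 = c * α ^ 2 / 2 - c * α * y + y ^ 2 * (c / 2) := by rw [hx]; ring
    have e2 : y ^ 2 * (1 / α + c / 2) = y ^ 2 / α + y ^ 2 * (c / 2) := by ring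
    have e3 : x * (1 - Real.log α) = α * (1 - Real.log α) - y * (1 - Real.log α) := by
      rw [hx]; ring
    linarith
  refine htot.trans (mul_nonpos_of_nonneg_of_nonpos (by positivity) ?_)
  refine scaled_overlap_exponent_nonpos hv hW hr hlog hmain hh0 ?_
  rw [hh, div_le_div_iff₀ (by positivity) (by positivity)]
  have := mul_le_mul_of_nonneg_right (show 2 * y ≤ r ^ 2 by linarith) hr.le
  linarith

/-- The Poisson type bound makes overlaps `x` between `2 * α ^ 2` and `α / 2` negligible: in terms
of `z = x / α ^ 2` the entropy `z * log z - z + 1` beats the gain `W * α * z ^ 2`, because `log z`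
dominates `W * α * z` up to `z = 1 / (2 * α)`. -/
theorem overlap_exponent_small_nonpos {W a x α c : ℝ} (hW : 6 ≤ W) (ha : 0 < a)
    (hc : c = 2 * W / a) (hα0 : 0 < α) (hαa : α ≤ a) (hlog : Real.log a = 1 - W)
    (hsmall : W * a ≤ 3 / 1000) (hx : 2 * α ^ 2 ≤ x) (hxα : x ≤ α / 2) :
    x - α ^ 2 - x * Real.log (x / α ^ 2) + c * x ^ 2 / 2 ≤ 0 := by
  obtain ⟨z, hz⟩ : ∃ z, z = x / α ^ 2 := ⟨_, rfl⟩
  have hxz : x = α ^ 2 * z := by rw [hz]; field_simp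
  have hz2 : 2 ≤ z := by rw [hz, le_div_iff₀ (by positivity)]; exact hx
  have hzα : z ≤ 1 / (2 * α) := by
    rw [hz, div_le_div_iff₀ (by positivity) (by positivity)]; nlinarith
  have hcα : c * α ^ 2 / 2 ≤ W * α := by
    rw [hc]
    calc 2 * W / a * α ^ 2 / 2 = W * α * (α / a) := by field_simp
      _ ≤ W * α * 1 := by gcongr; exact (div_le_one ha).2 hαa
      _ = W * α := mul_one _
  have hWα : W * α ≤ 3 / 1000 := le_trans (by gcongr) hsmall
  suffices h : z - 1 - z * Real.log z + W * α * z ^ 2 ≤ 0 by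
    have e : x - α ^ 2 - x * Real.log (x / α ^ 2) + c * x ^ 2 / 2
        = α ^ 2 * (z - 1 - z * Real.log z + c * α ^ 2 / 2 * z ^ 2) := by
      rw [← hz, hxz]; ring
    rw [e]
    refine mul_nonpos_of_nonneg_of_nonpos (by positivity) (le_trans ?_ h)
    gcongr
  have hz0 : 0 < z := by linarith
  have hlog2 := Real.log_two_gt_d9
  rcases le_total z (Real.exp 4) with h4 | h4
  · have he : z ≤ 55 := by
      refine h4.trans ?_
      have h1 := Real.exp_one_lt_d9
      have : Real.exp 4 = Real.exp 1 ^ 4 := by rw [← Real.exp_nat_mul]; norm_num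
      rw [this]
      calc Real.exp 1 ^ 4 ≤ 2.7182818286 ^ 4 := by gcongr
        _ ≤ 55 := by norm_num
    have h1 : z * (Real.log 2 + 1) - 2 ≤ z * Real.log z := by
      have := Real.log_le_sub_one_of_pos (show 0 < 2 / z by positivity)
      rw [Real.log_div two_ne_zero hz0.ne'] at this
      have h3 : z * (2 / z) = 2 := by field_simp
      nlinarith
    have h2 : W * α * z ^ 2 ≤ 3 / 1000 * (55 * z) := by
      have : z ^ 2 ≤ 55 * z := by nlinarith
      gcongr
    nlinarith
  · -- A quarter of `log z` pays for the constant, the rest for the quadratic term.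
    have hl4 : 4 ≤ Real.log z := (Real.le_log_iff_exp_le hz0).2 h4
    have hez : Real.exp 1 ≤ z := (Real.exp_le_exp.2 (by norm_num)).trans h4
    have hanti := Real.log_div_self_antitoneOn hez (hez.trans hzα) hzα
    have hlogZ : W - 1 - Real.log 2 ≤ Real.log (1 / (2 * α)) := by
      rw [one_div, Real.log_inv, Real.log_mul two_ne_zero hα0.ne']
      have := Real.log_le_log hα0 hαa
      linarith
    have h1 : 2 * α * z * (W - 1 - Real.log 2) ≤ Real.log z := by
      rw [le_div_iff₀ hz0] at hanti
      calc _ ≤ 2 * α * z * Real.log (1 / (2 * α)) :=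
            mul_le_mul_of_nonneg_left hlogZ (by positivity)
        _ = Real.log (1 / (2 * α)) / (1 / (2 * α)) * z := by field_simp
        _ ≤ Real.log z := hanti
    have hlog2' := Real.log_two_lt_d9
    have h2 : W * α * z ≤ 3 / 4 * Real.log z := by
      have : α * z * W ≤ α * z * (3 / 2 * (W - 1 - Real.log 2)) := by
        gcongr; linarith
      linarith
    have h3 : z * (1 - Real.log z + W * α * z) ≤ 0 :=
      mul_nonpos_of_nonneg_of_nonpos hz0.le (by linarith)
    nlinarith

/-! ### The second moment of the number of independent transversals -/

theorem factorial_le_exp (l : ℕ) :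
    (l.factorial : ℝ) ≤ Real.exp (1 + Real.log l + l * Real.log l - l) := by
  induction l with
  | zero => simp
  | succ l ih =>
    rcases Nat.eq_zero_or_pos l with rfl | hl
    · simp
    have hl' : (0 : ℝ) < l := by exact_mod_cast hl
    rw [Nat.factorial_succ, Nat.cast_mul]
    have h1 : ((l + 1 : ℕ) : ℝ) = Real.exp (Real.log (l + 1)) := by
      rw [Real.exp_log (by positivity)]; push_cast; rfl
    calc ((l + 1 : ℕ) : ℝ) * (l.factorial : ℝ)
        ≤ Real.exp (Real.log (l + 1)) * Real.exp (1 + Real.log l + l * Real.log l - l) := by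
          rw [h1]; gcongr
      _ ≤ _ := by
          rw [← Real.exp_add]
          apply Real.exp_le_exp.2
          have h2 := Real.log_le_sub_one_of_pos (show 0 < (l : ℝ) / (l + 1) by positivity)
          rw [Real.log_div hl'.ne' (by positivity)] at h2
          have h3 : (l : ℝ) / (l + 1) - 1 = -(1 / (l + 1)) := by field_simp; ring
          have h4 : ((l : ℝ) + 1) * (1 / (l + 1)) = 1 := by field_simp
          have h5 : 1 ≤ ((l : ℝ) + 1) * (Real.log (l + 1) - Real.log l) := by
            calc (1 : ℝ) = (l + 1) * (1 / (l + 1)) := h4.symm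
              _ ≤ _ := by gcongr; linarith
          push_cast
          linarith

theorem choose_le_exp (n k : ℕ) :
    (n.choose k : ℝ) ≤ Real.exp (k * (1 + Real.log (n / k))) := by
  rcases Nat.eq_zero_or_pos k with rfl | hk
  · simp
  rcases Nat.eq_zero_or_pos n with rfl | hn
  · rw [Nat.choose_eq_zero_of_lt hk]
    simpa using (Real.exp_pos _).le
  have hk' : (0 : ℝ) < k := by exact_mod_cast hk
  have hn' : (0 : ℝ) < n := by exact_mod_cast hn
  have h1 : (k : ℝ) ^ k / k.factorial ≤ Real.exp k := Real.pow_div_factorial_le_exp _ hk'.le k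
  have h2 : (n.choose k : ℝ) ≤ n ^ k / k.factorial := Nat.choose_le_pow_div k n
  have h3 : Real.exp (k * (1 + Real.log (n / k))) = Real.exp k * (n / k) ^ k := by
    rw [mul_add, mul_one, Real.exp_add, Real.exp_nat_mul, Real.exp_log (by positivity)]
  rw [h3]
  calc (n.choose k : ℝ) ≤ n ^ k / k.factorial := h2
    _ = (k : ℝ) ^ k / k.factorial * (n / k) ^ k := by
        rw [div_pow]; field_simp
    _ ≤ _ := by gcongr

theorem inv_one_sub_pow_choose_two_le {c : ℝ} (hc : 0 ≤ c) {n l : ℕ} (hn : 0 < n)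
    (hcn : 2 * c ≤ n) (hl : l ≤ n) :
    (1 / (1 - c / n : ℝ)) ^ l.choose 2 ≤ Real.exp (n * (c * (l / n : ℝ) ^ 2 / 2) + c ^ 2) := by
  have hn' : (0 : ℝ) < n := by exact_mod_cast hn
  have hl' : (l : ℝ) ≤ n := by exact_mod_cast hl
  set p : ℝ := c / n with hp
  have hp0 : 0 ≤ p := by positivity
  have hp2 : p ≤ 1 / 2 := by rw [hp, div_le_div_iff₀ hn' two_pos]; linarith
  have h1 : 1 / (1 - p) ≤ Real.exp (p + 2 * p ^ 2) := by
    have h2 : 1 / (1 - p) ≤ 1 + (p + 2 * p ^ 2) := by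
      rw [div_le_iff₀ (by linarith)]
      have : 0 ≤ p ^ 2 * (1 - 2 * p) := mul_nonneg (sq_nonneg p) (by linarith)
      linarith
    linarith [Real.add_one_le_exp (p + 2 * p ^ 2)]
  have hch : (l.choose 2 : ℝ) ≤ l ^ 2 / 2 := by
    have := Nat.choose_le_pow_div (α := ℝ) 2 l
    simpa using this
  calc (1 / (1 - p)) ^ l.choose 2 ≤ Real.exp (p + 2 * p ^ 2) ^ l.choose 2 := by
        have : 0 ≤ 1 / (1 - p) := one_div_nonneg.2 (by linarith)
        gcongr
    _ = Real.exp (l.choose 2 * (p + 2 * p ^ 2)) := by rw [Real.exp_nat_mul]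
    _ ≤ _ := by
        apply Real.exp_le_exp.2
        calc (l.choose 2 : ℝ) * (p + 2 * p ^ 2) ≤ l ^ 2 / 2 * (p + 2 * p ^ 2) := by gcongr
          _ = n * (c * (l / n : ℝ) ^ 2 / 2) + (l / n : ℝ) ^ 2 * c ^ 2 := by
              rw [hp]; field_simp
          _ ≤ n * (c * (l / n : ℝ) ^ 2 / 2) + 1 ^ 2 * c ^ 2 := by
              gcongr
              exact (div_le_one hn').2 hl'
          _ = _ := by ring

/-- The Poisson type bound for the number of overlaps of size `l`, at the optimal value
`z = x / α ^ 2` of the variable of the generating function. -/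
theorem card_filter_card_agreement_le_exp_of_ge {n m k l : ℕ} (hm : 0 < m) (hmn : 2 * m ≤ n)
    (hk : k ≤ n / m) (hk0 : 0 < k) (hl : l ≤ k) (hkl : (k / n : ℝ) ^ 2 ≤ l / n)
    {i : Finset (Fin (n / m)) × (Fin (n / m) → Fin m)} (hi : i ∈ transversals (n / m) m k) :
    (((transversals (n / m) m k).filter (fun j => (agreement i j).card = l)).card : ℝ)
      ≤ (transversals (n / m) m k).card * Real.exp (n * ((l / n : ℝ) - (k / n : ℝ) ^ 2
        - (l / n : ℝ) * Real.log ((l / n : ℝ) / (k / n : ℝ) ^ 2)) + 2 * m) := by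
  have hm' : (0 : ℝ) < m := by exact_mod_cast hm
  have hk0' : (0 : ℝ) < k := by exact_mod_cast hk0
  have hn : 0 < n := by omega
  have hn' : (0 : ℝ) < n := by exact_mod_cast hn
  have hN : 0 < n / m := hk0.trans_le hk
  have hln : (l : ℝ) ≤ n := by exact_mod_cast hl.trans (hk.trans (Nat.div_le_self _ _))
  set x : ℝ := l / n with hx
  set α : ℝ := k / n with hα
  set z : ℝ := x / α ^ 2 with hz
  have hα0 : 0 < α := by positivity
  have hz1 : 1 ≤ z := (one_le_div (by positivity)).2 hkl
  have hz0 : 0 < z := by linarith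
  have hx1 : x ≤ 1 := (div_le_one hn').2 hln
  set T := transversals (n / m) m k with hT
  have h1 := sum_pow_card_agreement_le hk hm hN hi hz1
  have h2 : ((T.filter (fun j => (agreement i j).card = l)).card : ℝ) * z ^ l
      ≤ ∑ j ∈ T, z ^ (agreement i j).card := by
    rw [← nsmul_eq_mul, ← Finset.sum_const]
    calc _ = ∑ j ∈ T.filter (fun j => (agreement i j).card = l), z ^ (agreement i j).card := by
          refine Finset.sum_congr rfl fun j hj => ?_
          rw [(Finset.mem_filter.1 hj).2]
      _ ≤ _ := Finset.sum_le_sum_of_subset_of_nonneg (Finset.filter_subset _ _)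
          fun _ _ _ => pow_nonneg hz0.le _
  have h3 : (z - 1) * k ^ 2 / ((n / m : ℕ) * m) ≤ n * (x - α ^ 2) + 2 * m := by
    have hNm : (n : ℝ) - m ≤ (n / m : ℕ) * m := by
      have h4 := Nat.lt_div_mul_add hm (a := n)
      have h5 : (n : ℝ) ≤ (n / m : ℕ) * m + m := by exact_mod_cast h4.le
      linarith
    have hmn' : 2 * (m : ℝ) ≤ n := by exact_mod_cast hmn
    have hnm0 : (0 : ℝ) < n - m := by linarith
    have hzα : (z - 1) * α ^ 2 = x - α ^ 2 := by rw [hz]; field_simp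
    have hkα : (k : ℝ) = α * n := by rw [hα]; field_simp
    calc _ ≤ (z - 1) * k ^ 2 / (n - m) := by
          apply div_le_div_of_nonneg_left _ hnm0 hNm
          exact mul_nonneg (by linarith) (sq_nonneg _)
      _ = (x - α ^ 2) * (n ^ 2 / (n - m)) := by rw [hkα, ← hzα]; ring
      _ ≤ (x - α ^ 2) * (n + 2 * m) := by
          apply mul_le_mul_of_nonneg_left _ (by linarith)
          rw [div_le_iff₀ hnm0]
          nlinarith
      _ = n * (x - α ^ 2) + 2 * m * (x - α ^ 2) := by ring
      _ ≤ n * (x - α ^ 2) + 2 * m * 1 := by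
          gcongr
          linarith [sq_nonneg α]
      _ = _ := by ring
  have h4 : z ^ l = Real.exp (n * (x * Real.log z)) := by
    rw [← mul_assoc, show (n : ℝ) * x = l by rw [hx]; field_simp, Real.exp_nat_mul,
      Real.exp_log hz0]
  rw [← le_div_iff₀ (by positivity), h4, div_eq_mul_inv, ← Real.exp_neg] at h2
  refine h2.trans ?_
  calc _ ≤ (T.card : ℝ) * Real.exp (n * (x - α ^ 2) + 2 * m) *
          Real.exp (-(n * (x * Real.log z))) := by
        gcongr
        exact h1.trans (by gcongr)
    _ = _ := by
        rw [mul_assoc, ← Real.exp_add]; congr 2; ring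

/-- The union bound for the number of overlaps of size `l`. The term `2 * m * x ^ 2` is the cost of
the restriction to transversals. At `l = k` the
summand `0 * (1 + log (_ / 0))` is `0`, the exponent of `k.choose k = 1`. -/
theorem card_filter_card_agreement_le_exp {n m k l : ℕ} (hm : 0 < m)
    (hk0 : 0 < k) (hl : l ≤ k) (hkm : 2 * (k * m) ≤ n)
    {i : Finset (Fin (n / m)) × (Fin (n / m) → Fin m)} (hi : i ∈ transversals (n / m) m k) :
    (((transversals (n / m) m k).filter (fun j => (agreement i j).card = l)).card : ℝ)
      ≤ (transversals (n / m) m k).card * (n * Real.exp (n * (2 * (((k : ℝ) / n - l / n) *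
        (1 + Real.log ((k / n : ℝ) / ((k : ℝ) / n - l / n)))) -
        (l / n : ℝ) * (1 - Real.log (l / n : ℝ)) + 2 * m * (l / n : ℝ) ^ 2) + 1)) := by
  have hm' : (0 : ℝ) < m := by exact_mod_cast hm
  have hk0' : (0 : ℝ) < k := by exact_mod_cast hk0
  have hn : 0 < n := by
    have := Nat.mul_pos hk0 hm
    omega
  have hn' : (0 : ℝ) < n := by exact_mod_cast hn
  have hk : k ≤ n / m := (Nat.le_div_iff_mul_le hm).2 (by omega)
  have hln : l ≤ n := hl.trans (hk.trans (Nat.div_le_self _ _))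
  have h1 := card_filter_card_agreement_le hk l hl hi
  set T := transversals (n / m) m k with hT
  set M := (T.filter (fun j => (agreement i j).card = l)).card
  have hlm : 2 * ((l : ℝ) * m) ≤ n := by
    have : 2 * (l * m) ≤ n := le_trans (by gcongr) hkm
    exact_mod_cast this
  have hpos : (0 : ℝ) < n - l * m := by linarith
  -- A lower bound for `(n / m).choose l * m ^ l`.
  have h2 : ((n : ℝ) - l * m) ^ l ≤ ((n / m).choose l * m ^ l : ℕ) * l.factorial := by
    have h3 : (n - l * m) ^ l ≤ (n / m).choose l * m ^ l * l.factorial := by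
      calc (n - l * m) ^ l ≤ ((n / m + 1 - l) * m) ^ l := by
            apply Nat.pow_le_pow_left
            have := Nat.lt_div_mul_add hm (a := n)
            rw [Nat.sub_mul, Nat.add_mul]
            omega
        _ = (n / m + 1 - l) ^ l * m ^ l := by rw [mul_pow]
        _ ≤ (n / m).descFactorial l * m ^ l := by
            gcongr; exact Nat.pow_sub_le_descFactorial _ _
        _ = _ := by rw [Nat.descFactorial_eq_factorial_mul_choose]; ring
    have h4 : ((n - l * m : ℕ) : ℝ) = n - l * m := by
      rw [Nat.cast_sub]
      · push_cast; rfl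
      · exact_mod_cast (by linarith : (l : ℝ) * m ≤ n)
    rw [← h4]
    exact_mod_cast h3
  have h5 : (l.factorial : ℝ) ≤ n * Real.exp (1 + l * Real.log l - l) := by
    rcases Nat.eq_zero_or_pos l with rfl | hl0
    · simp only [Nat.factorial_zero, Nat.cast_one, CharP.cast_eq_zero, zero_mul, add_zero,
        sub_zero]
      have : (1 : ℝ) ≤ n := by exact_mod_cast hn
      have := Real.add_one_le_exp (1 : ℝ)
      nlinarith
    · have hl0' : (0 : ℝ) < l := by exact_mod_cast hl0
      calc (l.factorial : ℝ) ≤ _ := factorial_le_exp l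
        _ = l * Real.exp (1 + l * Real.log l - l) := by
            rw [show 1 + Real.log l + l * Real.log l - l
              = Real.log l + (1 + l * Real.log l - l) by ring, Real.exp_add, Real.exp_log hl0']
        _ ≤ _ := by gcongr
  set x : ℝ := l / n with hx
  have hx0 : 0 ≤ x := by positivity
  have hlx : (l : ℝ) = n * x := by rw [hx]; field_simp
  have h6 : Real.exp (l * Real.log n - n * (2 * m * x ^ 2)) ≤ ((n : ℝ) - l * m) ^ l := by
    have hxm : x * m ≤ 1 / 2 := by
      rw [hx, div_mul_eq_mul_div, div_le_div_iff₀ hn' two_pos]; linarith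
    have h7 : -(2 * (x * m)) ≤ Real.log (1 - x * m) := by
      have h8 : 0 < 1 - x * m := by linarith
      have h9 := Real.one_sub_inv_le_log_of_pos h8
      have h10 : (1 - x * m)⁻¹ ≤ 1 + 2 * (x * m) := by
        rw [inv_le_iff_one_le_mul₀ h8]
        have : 0 ≤ x * m * (1 - 2 * (x * m)) := mul_nonneg (by positivity) (by linarith)
        linarith
      linarith
    have h11 : (n : ℝ) - l * m = n * (1 - x * m) := by rw [hlx]; ring
    have h12 : ((n : ℝ) - l * m) ^ l = Real.exp (l * Real.log (n - l * m)) := by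
      rw [Real.exp_nat_mul, Real.exp_log hpos]
    rw [h12, h11, Real.log_mul hn'.ne' (by linarith)]
    apply Real.exp_le_exp.2
    calc l * Real.log n - n * (2 * m * x ^ 2) = l * (Real.log n + -(2 * (x * m))) := by
          rw [hlx]; ring
      _ ≤ _ := by gcongr
  have h13 : (k.choose l : ℝ) ^ 2 ≤ Real.exp (n * (2 * (((k : ℝ) / n - x) *
        (1 + Real.log ((k / n : ℝ) / ((k : ℝ) / n - x)))))) := by
    rw [← Nat.choose_symm hl]
    have h14 := choose_le_exp k (k - l)
    have h15 : ((k - l : ℕ) : ℝ) = n * ((k : ℝ) / n - x) := by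
      rw [Nat.cast_sub hl, hx]; field_simp
    have h16 : (k : ℝ) / (k - l : ℕ) = (k / n : ℝ) / ((k : ℝ) / n - x) := by
      rw [h15, div_div]
    rw [h16, h15] at h14
    calc _ ≤ _ := pow_le_pow_left₀ (Nat.cast_nonneg _) h14 2
      _ = _ := by rw [← Real.exp_nat_mul]; congr 1; push_cast; ring
  have h17 : (M : ℝ) * ((n / m).choose l * m ^ l : ℕ) ≤ T.card * (k.choose l : ℝ) ^ 2 := by
    exact_mod_cast h1
  have hlog : (l : ℝ) * Real.log l = l * Real.log n + n * (x * Real.log x) := by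
    rcases Nat.eq_zero_or_pos l with rfl | hl0
    · simp [hx]
    · have hl0' : (0 : ℝ) < l := by exact_mod_cast hl0
      rw [hx, Real.log_div hl0'.ne' hn'.ne', hx.symm, ← mul_assoc, ← hlx]; ring
  have h18 : (M : ℝ) * Real.exp (l * Real.log n - n * (2 * m * x ^ 2))
      ≤ T.card * Real.exp (n * (2 * (((k : ℝ) / n - x) *
        (1 + Real.log ((k / n : ℝ) / ((k : ℝ) / n - x)))))) *
        (n * Real.exp (1 + l * Real.log l - l)) := by
    calc _ ≤ (M : ℝ) * (((n / m).choose l * m ^ l : ℕ) * l.factorial) := by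
          exact mul_le_mul_of_nonneg_left (h6.trans h2) (Nat.cast_nonneg _)
      _ = (M : ℝ) * ((n / m).choose l * m ^ l : ℕ) * l.factorial := by ring
      _ ≤ T.card * (k.choose l : ℝ) ^ 2 * l.factorial :=
          mul_le_mul_of_nonneg_right h17 (Nat.cast_nonneg _)
      _ ≤ _ := mul_le_mul (mul_le_mul_of_nonneg_left h13 (Nat.cast_nonneg _)) h5
          (Nat.cast_nonneg _) (mul_nonneg (Nat.cast_nonneg _) (Real.exp_pos _).le)
  rw [← le_div_iff₀ (Real.exp_pos _), div_eq_mul_inv, ← Real.exp_neg] at h18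
  refine h18.trans (le_of_eq ?_)
  calc _ = (T.card : ℝ) * (n * (Real.exp (n * (2 * (((k : ℝ) / n - x) *
        (1 + Real.log ((k / n : ℝ) / ((k : ℝ) / n - x)))))) *
        Real.exp (1 + l * Real.log l - l) *
        Real.exp (-(l * Real.log n - n * (2 * m * x ^ 2))))) := by ring
    _ = _ := by
      rw [← Real.exp_add, ← Real.exp_add, hlog]
      congr 3
      rw [hlx]
      ring

/-- The second moment bound in terms of the exponents: it suffices that every overlap `x = l / n`
satisfies one of three bounds, whose left sides are the exponents that result from the trivial
bound, the Poisson type bound and the union bound for the number of overlaps. -/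
theorem exp_neg_le_pi_edgeLaw_real {c δ : ℝ} (hc : 0 < c) {n m k : ℕ} (hm : 0 < m)
    (hcn : 2 * c ≤ n) (hmn : 2 * m ≤ n) (hk0 : 0 < k) (hkm : 2 * (k * m) ≤ n)
    (hδ : ∀ l : ℕ, l ≤ k → ∀ x α : ℝ, x = l / n → α = k / n →
      c * x ^ 2 / 2 ≤ δ ∨
      (α ^ 2 ≤ x ∧ x - α ^ 2 - x * Real.log (x / α ^ 2) + c * x ^ 2 / 2 ≤ δ) ∨
      2 * ((α - x) * (1 + Real.log (α / (α - x)))) - x * (1 - Real.log x) + 2 * m * x ^ 2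
        + c * x ^ 2 / 2 ≤ δ)
    (h : n / m * m ≤ n) :
    ((k + 1) * (n * Real.exp (n * δ + (1 + 2 * m + c ^ 2))))⁻¹
      ≤ (Measure.pi (edgeLaw (Fin n) (edgeProb c n))).real
        {ω | ∃ i ∈ transversals (n / m) m k, SpansNoEdge ω (transversalSet h i)} := by
  have hn : 0 < n := by omega
  have hn' : (0 : ℝ) < n := by exact_mod_cast hn
  have hn1 : (1 : ℝ) ≤ n := by exact_mod_cast hn
  have hk : k ≤ n / m := (Nat.le_div_iff_mul_le hm).2 (by omega)
  have hp : (edgeProb c n : ℝ) = c / n := by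
    unfold edgeProb
    rw [Set.projIcc_of_mem]
    exact ⟨by positivity, (div_le_one hn').2 (by linarith)⟩
  have hp1 : (edgeProb c n : ℝ) < 1 := by
    rw [hp, div_lt_one hn']; linarith
  set T := transversals (n / m) m k with hT
  have hTcard : 0 < T.card := by
    rw [hT, card_transversals]
    exact Nat.mul_pos (Nat.choose_pos hk) (pow_pos hm _)
  refine inv_le_pi_edgeLaw_real_exists _ hp1 T (Finset.card_pos.1 hTcard) _ k ?_ _
    (by positivity) ?_
  · intro i hi
    rw [card_transversalSet]
    simpa [hT, transversals] using hi
  intro i hi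
  have hi' : i.1.card = k := by simpa [hT, transversals] using hi
  rw [hp]
  simp_rw [card_transversalSet_inter]
  have hmaps : ∀ j ∈ T, (agreement i j).card ∈ Finset.range (k + 1) := by
    intro j _
    rw [Finset.mem_range, Nat.lt_succ_iff, ← hi']
    exact Finset.card_le_card ((Finset.filter_subset _ _).trans Finset.inter_subset_left)
  rw [← Finset.sum_fiberwise_of_maps_to hmaps]
  calc _ ≤ ∑ l ∈ Finset.range (k + 1),
        T.card * (n * Real.exp (n * δ + (1 + 2 * m + c ^ 2))) := by
        refine Finset.sum_le_sum fun l hl => ?_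
        have hl' : l ≤ k := Nat.lt_succ_iff.1 (Finset.mem_range.1 hl)
        have hln : l ≤ n := hl'.trans (hk.trans (Nat.div_le_self _ _))
        have hq := inv_one_sub_pow_choose_two_le hc.le hn hcn hln
        rw [Finset.sum_congr rfl (g := fun _ => (1 / (1 - c / n : ℝ)) ^ l.choose 2)
          (fun j hj => by rw [(Finset.mem_filter.1 hj).2]), Finset.sum_const, nsmul_eq_mul]
        have hM := Finset.card_le_card (Finset.filter_subset
          (fun j => (agreement i j).card = l) T)
        -- Both remaining factors are at most exponentials.
        have key : ∀ A B : ℝ, 0 ≤ B → B ≤ 1 + 2 * m →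
            ((T.filter (fun j => (agreement i j).card = l)).card : ℝ)
              ≤ T.card * (n * Real.exp (n * A + B)) →
            A + c * (l / n : ℝ) ^ 2 / 2 ≤ δ →
            ((T.filter (fun j => (agreement i j).card = l)).card : ℝ) *
              (1 / (1 - c / n : ℝ)) ^ l.choose 2
              ≤ T.card * (n * Real.exp (n * δ + (1 + 2 * m + c ^ 2))) := by
          intro A B hB0 hB hAB hA
          calc _ ≤ (T.card * (n * Real.exp (n * A + B))) *
                Real.exp (n * (c * (l / n : ℝ) ^ 2 / 2) + c ^ 2) := by
                have : 0 ≤ 1 / (1 - c / n : ℝ) := by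
                  rw [← hp]; exact one_div_nonneg.2 (by linarith)
                gcongr
            _ = T.card * (n * Real.exp (n * (A + c * (l / n : ℝ) ^ 2 / 2) + (B + c ^ 2))) := by
                rw [mul_assoc, mul_assoc, ← Real.exp_add]; congr 3; ring
            _ ≤ _ := by gcongr
        rcases hδ l hl' _ _ rfl rfl with h1 | ⟨h1, h2⟩ | h1
        · refine key 0 0 le_rfl (by positivity) ?_ (by linarith)
          simp only [mul_zero, add_zero, Real.exp_zero, mul_one]
          calc _ ≤ (T.card : ℝ) := by exact_mod_cast hM
            _ = T.card * 1 := (mul_one _).symm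
            _ ≤ _ := by gcongr
        · refine key _ (2 * m) (by positivity) (by linarith) ?_ h2
          refine (card_filter_card_agreement_le_exp_of_ge hm hmn hk hk0 hl' h1 hi).trans ?_
          gcongr
          exact le_mul_of_one_le_left (Real.exp_pos _).le hn1
        · exact key _ 1 zero_le_one (by linarith [Nat.cast_nonneg (α := ℝ) m])
            (card_filter_card_agreement_le_exp hm hk0 hl' hkm hi) h1
    _ = _ := by
        rw [Finset.sum_const, Finset.card_range, nsmul_eq_mul]; push_cast; ring

/-! ### Order properties, and the first moment bound -/

theorem lambertW_pos {z : ℝ} (hz : 0 < z) : 0 < lambertW z := by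
  rw [lambertW, dif_pos hz]
  exact (existsUnique_pos_mul_exp_eq hz).choose_spec.1.1

theorem lambertW_mul_exp {z : ℝ} (hz : 0 < z) : lambertW z * Real.exp (lambertW z) = z := by
  rw [lambertW, dif_pos hz]
  exact (existsUnique_pos_mul_exp_eq hz).choose_spec.1.2

theorem probIndep_le_one (c α : ℝ) (n : ℕ) : probIndep c α n ≤ 1 := measureReal_le_one

theorem probIndep_nonneg (c α : ℝ) (n : ℕ) : 0 ≤ probIndep c α n := measureReal_nonneg

theorem probIndep_zero (c : ℝ) (n : ℕ) : probIndep c 0 n = 1 := by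
  unfold probIndep
  have : {G : SimpleGraph (Fin n) | ∃ s : Finset (Fin n), G.IsNIndepSet ⌈(0 : ℝ) * n⌉₊ s}
      = Set.univ := by
    ext G
    simp [SimpleGraph.isNIndepSet_iff, SimpleGraph.IsIndepSet]
  rw [this]
  simp

theorem probIndep_antitone (c : ℝ) (n : ℕ) : Antitone fun α => probIndep c α n := by
  intro α β hαβ
  simp only [probIndep_eq_pi]
  refine measureReal_mono ?_
  rintro ω ⟨S, hS, hcard⟩
  have : ⌈α * n⌉₊ ≤ S.card := by
    rw [hcard]
    gcongr
  obtain ⟨T, hT, hTc⟩ := Finset.exists_subset_card_eq this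
  exact ⟨T, spansNoEdge_mono hT hS, hTc⟩

theorem le_of_tendsto_probIndep {c α β : ℝ} (hα : Tendsto (probIndep c α) atTop (𝓝 1))
    (hβ : Tendsto (probIndep c β) atTop (𝓝 0)) : α ≤ β := by
  by_contra! h
  have := le_of_tendsto_of_tendsto' hα hβ fun n => probIndep_antitone c n h.le
  norm_num at this

theorem le_alphaCritLower {c α β : ℝ} (hα0 : 0 ≤ α)
    (hα : Tendsto (probIndep c α) atTop (𝓝 1)) (hβ : Tendsto (probIndep c β) atTop (𝓝 0)) :
    α ≤ alphaCritLower c :=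
  le_csSup ⟨β, fun _ hx => le_of_tendsto_probIndep hx.2 hβ⟩ ⟨hα0, hα⟩

theorem alphaCritLower_le {c β : ℝ} (hβ : Tendsto (probIndep c β) atTop (𝓝 0)) :
    alphaCritLower c ≤ β :=
  csSup_le ⟨0, le_rfl, by simp [funext (probIndep_zero c)]⟩
    fun _ hx => le_of_tendsto_probIndep hx.2 hβ

theorem alphaCritUpper_le {c β : ℝ} (hβ0 : 0 ≤ β)
    (hβ : Tendsto (probIndep c β) atTop (𝓝 0)) : alphaCritUpper c ≤ β :=
  csInf_le ⟨0, fun _ hx => hx.1⟩ ⟨hβ0, hβ⟩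

theorem alphaCritLower_le_alphaCritUpper {c β : ℝ} (hβ0 : 0 ≤ β)
    (hβ : Tendsto (probIndep c β) atTop (𝓝 0)) : alphaCritLower c ≤ alphaCritUpper c :=
  le_csInf ⟨β, hβ0, hβ⟩ fun _ hx => alphaCritLower_le hx.2

theorem IsAlphaCrit.nonneg {c a : ℝ} (h : IsAlphaCrit c a) : 0 ≤ a := by
  by_contra! ha
  have h1 := h.2 0 le_rfl ha
  rw [funext (probIndep_zero c)] at h1
  exact one_ne_zero (tendsto_nhds_unique tendsto_const_nhds h1)

theorem IsAlphaCrit.alphaCritLower_eq_and_alphaCritUpper_eq {c a : ℝ} (h : IsAlphaCrit c a) :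
    alphaCritLower c = a ∧ alphaCritUpper c = a := by
  have ha := h.nonneg
  have h1 : Tendsto (probIndep c (a + 1)) atTop (𝓝 0) := h.2 _ (by linarith) (by linarith)
  have hlow : a ≤ alphaCritLower c := by
    refine le_of_forall_lt fun x hx => ?_
    rcases ha.eq_or_lt with h0 | h0
    · refine hx.trans_le ?_
      rw [← h0]
      exact le_alphaCritLower le_rfl (by simp [funext (probIndep_zero c)]) h1
    · obtain ⟨t, ht1, ht2⟩ := exists_between (max_lt hx h0)
      have ht0 : 0 ≤ t := (le_max_right _ _).trans ht1.le
      exact (le_max_left _ _).trans_lt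
        (ht1.trans_le (le_alphaCritLower ht0 (h.1 t ht0 ht2) h1))
  have hup : alphaCritUpper c ≤ a :=
    le_of_forall_gt_imp_ge_of_dense fun t ht =>
      alphaCritUpper_le (by linarith) (h.2 t (by linarith) ht)
  have hmid := alphaCritLower_le_alphaCritUpper (by linarith) h1
  exact ⟨le_antisymm (hmid.trans hup) hlow, le_antisymm hup (hlow.trans hmid)⟩

theorem probIndep_le_choose_mul {c α : ℝ} (hc : 0 ≤ c) {n : ℕ} (hn : 0 < n) (hcn : c ≤ n) :
    probIndep c α n
      ≤ n.choose ⌈α * n⌉₊ * (1 - c / n : ℝ) ^ (⌈α * n⌉₊).choose 2 := by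
  have hn' : (0 : ℝ) < n := by exact_mod_cast hn
  have hp : (edgeProb c n : ℝ) = c / n := by
    unfold edgeProb
    rw [Set.projIcc_of_mem]
    exact ⟨by positivity, (div_le_one hn').2 hcn⟩
  rw [probIndep_eq_pi]
  set k := ⌈α * n⌉₊
  have hsub : {ω : Sym2 (Fin n) → Prop | ∃ S : Finset (Fin n), SpansNoEdge ω S ∧ S.card = k}
      ⊆ ⋃ S ∈ Finset.powersetCard k (Finset.univ : Finset (Fin n)), {ω | SpansNoEdge ω S} := by
    rintro ω ⟨S, hS, hcard⟩
    simp only [Set.mem_iUnion]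
    exact ⟨S, Finset.mem_powersetCard.2 ⟨Finset.subset_univ _, hcard⟩, hS⟩
  refine (measureReal_mono hsub (measure_ne_top _ _)).trans
    ((measureReal_biUnion_finset_le _ _).trans (le_of_eq ?_))
  rw [Finset.sum_congr rfl (g := fun _ => (1 - c / n : ℝ) ^ k.choose 2)]
  · simp
  · intro S hS
    rw [pi_edgeLaw_real_spansNoEdge, hp, (Finset.mem_powersetCard.1 hS).2]

/-- If the first moment exponent is negative at `α`, the expected number of independent sets of
density `α` decays exponentially. -/
theorem tendsto_probIndep_zero {c α : ℝ} (hc : 0 < c) (hα : 0 < α)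
    (h : 1 - Real.log α < c * α / 2) : Tendsto (probIndep c α) atTop (𝓝 0) := by
  obtain ⟨η, hη⟩ : ∃ η, η = (c * α / 2 - (1 - Real.log α)) / 2 := ⟨_, rfl⟩
  have hη0 : 0 < η := by rw [hη]; linarith
  have hlim : Tendsto (fun n : ℕ => Real.exp (-(η * α) * n)) atTop (𝓝 0) := by
    refine Real.tendsto_exp_atBot.comp ?_
    exact tendsto_natCast_atTop_atTop.const_mul_atTop_of_neg (by nlinarith)
  refine squeeze_zero' (Eventually.of_forall fun n => probIndep_nonneg c α n) ?_ hlim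
  filter_upwards [eventually_ge_atTop 1, tendsto_natCast_atTop_atTop.eventually_ge_atTop c,
    tendsto_natCast_atTop_atTop.eventually_ge_atTop (c / (2 * η))] with n hn hcn hηn
  have hn' : (0 : ℝ) < n := by exact_mod_cast hn
  refine (probIndep_le_choose_mul hc.le hn hcn).trans ?_
  set k := ⌈α * n⌉₊ with hk
  have hkα : α * n ≤ k := Nat.le_ceil _
  have hk0 : (0 : ℝ) < k := lt_of_lt_of_le (by positivity) hkα
  have h1 := choose_le_exp n k
  have h2 : (1 - c / n : ℝ) ^ k.choose 2 ≤ Real.exp (k * (-(c / n * ((k - 1) / 2)))) := by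
    have h3 : (1 - c / n : ℝ) ≤ Real.exp (-(c / n)) := by
      linarith [Real.add_one_le_exp (-(c / n))]
    have h4 : 0 ≤ (1 - c / n : ℝ) := by
      have := (div_le_one hn').2 hcn
      linarith
    refine (pow_le_pow_left₀ h4 h3 _).trans (le_of_eq ?_)
    rw [← Real.exp_nat_mul, Nat.cast_choose_two]
    congr 1
    ring
  calc _ ≤ Real.exp (k * (1 + Real.log (n / k))) * Real.exp (k * (-(c / n * ((k - 1) / 2)))) :=
        mul_le_mul h1 h2 (by
          have := (div_le_one hn').2 hcn
          exact pow_nonneg (by linarith) _) (Real.exp_pos _).le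
    _ = Real.exp (k * (1 + Real.log (n / k) - c / n * ((k - 1) / 2))) := by
        rw [← Real.exp_add]; congr 1; ring
    _ ≤ Real.exp (k * (-η)) := by
        gcongr
        have h5 : Real.log (n / k) ≤ -Real.log α := by
          rw [← Real.log_inv]
          apply Real.log_le_log (by positivity)
          rw [div_le_iff₀ hk0, inv_mul_eq_div, le_div_iff₀ hα]
          linarith
        have h6 : c * α / 2 - η ≤ c / n * ((k - 1) / 2) := by
          have h7 : c / n * ((α * n - 1) / 2) ≤ c / n * ((k - 1) / 2) := by gcongr
          have h8 : c / n * ((α * n - 1) / 2) = c * α / 2 - c / (2 * n) := by field_simp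
          have h9 : c / (2 * n) ≤ η := by
            rw [div_le_iff₀ (by positivity)] at hηn ⊢
            linarith
          linarith
        linarith
    _ ≤ _ := by
        apply Real.exp_le_exp.2
        nlinarith

theorem tendsto_probIndep_zero_of_lambertW_lt {c α : ℝ} (hc : 0 < c)
    (h : 2 / c * lambertW (Real.exp 1 * c / 2) < α) :
    Tendsto (probIndep c α) atTop (𝓝 0) := by
  have hz : 0 < Real.exp 1 * c / 2 := by positivity
  have hW := lambertW_pos hz
  have hWz := lambertW_mul_exp hz
  set W := lambertW (Real.exp 1 * c / 2)
  have ha : 0 < 2 / c * W := by positivity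
  have hlog : 1 - Real.log (2 / c * W) = W := by
    have h1 : 2 / c * W = Real.exp (1 - W) := by
      rw [Real.exp_sub, eq_div_iff (Real.exp_pos _).ne', mul_assoc, hWz]
      field_simp
    rw [h1, Real.log_exp]; ring
  refine tendsto_probIndep_zero hc (ha.trans h) ?_
  have h1 := Real.log_lt_log ha h
  have h2 : c * (2 / c * W) = 2 * W := by field_simp
  have h3 := mul_lt_mul_of_pos_left h hc
  linarith

theorem tendsto_pow_mul_exp_half_atTop (j : ℕ) :
    Tendsto (fun W : ℝ => W ^ j * Real.exp ((1 - W) / 2)) atTop (𝓝 0) := by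
  have h1 := (Real.tendsto_pow_mul_exp_neg_atTop_nhds_zero j).comp
    (tendsto_id.atTop_div_const (r := (2 : ℝ)) two_pos)
  have h2 := h1.const_mul (Real.exp (1 / 2) * 2 ^ j)
  rw [mul_zero] at h2
  refine h2.congr fun W => ?_
  simp only [Function.comp, id]
  rw [show (1 - W) / 2 = 1 / 2 + -(W / 2) by ring, Real.exp_add, div_pow]
  field_simp

/-! ### High probability below the root of the first moment exponent -/

/-- All overlaps satisfy one of the three bounds of `exp_neg_le_pi_edgeLaw_real`, for densities
slightly below `r ^ 2`, the root of the first moment exponent. -/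
theorem overlap_exponent_trichotomy {W r c m u₁ u₂ α x : ℝ} (hu₂ : 0 < u₂) (hu₁ : 0 < u₁)
    (hW : 8 + u₁ ≤ W) (hr : 0 < r) (hlog : 2 * Real.log r = 1 - W) (hc : c = 2 * W / r ^ 2)
    (hm : 0 ≤ m) (hur : u₁ * r ≤ 1 / 2) (hsmall : W * r ^ 2 ≤ 3 / 1000)
    (hmain : 2 / Real.exp 1 + 8 * u₁ * r + 16 * r * (W + 2) + 2 * m * r ≤ u₂ * (1 - u₁ * r / W))
    (hα₁ : r ^ 2 * (1 - u₁ * r / W) ≤ α) (hα₂ : α ≤ r ^ 2 * (1 - u₂ * r / W))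
    (hx0 : 0 ≤ x) (hxα : x ≤ α) :
    c * x ^ 2 / 2 ≤ 4 * W * r ^ 6 ∨
      (α ^ 2 ≤ x ∧ x - α ^ 2 - x * Real.log (x / α ^ 2) + c * x ^ 2 / 2 ≤ 4 * W * r ^ 6) ∨
      2 * ((α - x) * (1 + Real.log (α / (α - x)))) - x * (1 - Real.log x) + 2 * m * x ^ 2
        + c * x ^ 2 / 2 ≤ 4 * W * r ^ 6 := by
  have h0r : 0 < r ^ 2 := by positivity
  obtain ⟨v, hv⟩ : ∃ v, v = (1 - α / r ^ 2) * W / r := ⟨_, rfl⟩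
  have hW0 : 0 < W := by linarith
  have hαv : α = r ^ 2 * (1 - v * r / W) := by
    rw [hv]; field_simp; ring
  have hvle : v ≤ u₁ := by
    rw [hαv] at hα₁
    have h1 := le_of_mul_le_mul_left hα₁ h0r
    have h2 : v * r / W ≤ u₁ * r / W := by linarith
    exact le_of_mul_le_mul_right ((div_le_div_iff_of_pos_right hW0).1 h2) hr
  have hvge : u₂ ≤ v := by
    rw [hαv] at hα₂
    have h1 := le_of_mul_le_mul_left hα₂ h0r
    have h2 : u₂ * r / W ≤ v * r / W := by linarith
    exact le_of_mul_le_mul_right ((div_le_div_iff_of_pos_right hW0).1 h2) hr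
  have hv0 : 0 < v := hu₂.trans_le hvge
  have hvr : v * r / W ≤ u₁ * r / W := by gcongr
  have hurW : u₁ * r / W ≤ 1 / 2 := by
    rw [div_le_iff₀ hW0]; linarith
  have hα0 : 0 < α := by
    rw [hαv]; apply mul_pos h0r; linarith
  have hαr : α ≤ r ^ 2 := by
    rw [hαv]
    have : 0 ≤ v * r / W := by positivity
    have := mul_le_mul_of_nonneg_left (show 1 - v * r / W ≤ 1 by linarith) h0r.le
    linarith
  have hδ0 : 0 ≤ 4 * W * r ^ 6 := by positivity
  rcases le_total x (2 * α ^ 2) with h | h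
  · left
    calc c * x ^ 2 / 2 ≤ c * (2 * α ^ 2) ^ 2 / 2 := by
          have : 0 ≤ c := by rw [hc]; positivity
          gcongr
      _ ≤ c * (2 * (r ^ 2) ^ 2) ^ 2 / 2 := by
          have : 0 ≤ c := by rw [hc]; positivity
          gcongr
      _ = _ := by rw [hc]; field_simp; ring
  · right
    rcases le_total x (α / 2) with h2 | h2
    · left
      refine ⟨by nlinarith, ?_⟩
      refine (overlap_exponent_small_nonpos (W := W) (a := r ^ 2) ?_ h0r hc hα0 hαr ?_ hsmall
        h h2).trans hδ0
      · linarith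
      · rw [Real.log_pow]; push_cast; exact hlog
    · right
      refine (overlap_exponent_large_nonpos (W := W) (r := r) (v := v) hv0 (by linarith) hr hlog hm
        hαv hc (hvr.trans hurW) ?_ (by linarith) (by linarith) (by ring)).trans hδ0
      have e1 : 8 * v * r ≤ 8 * u₁ * r := by gcongr
      have e2 : u₂ * (1 - u₁ * r / W) ≤ v * (1 - v * r / W) :=
        mul_le_mul hvge (by linarith) (by linarith) hv0.le
      linarith

/-- The size `k` of the transversals in the second moment method is chosen at density
`r ^ 2 - u₁ * r ^ 3 / W`, and the bounded differences inequality then costs a density of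
`2 * τ = (u - u₁) * r ^ 3 / (2 * W)`. -/
theorem tendsto_probIndep_one_of_bounds {W r c u u₁ u₂ : ℝ} {m : ℕ} (hu₂ : 0 < u₂) (hu₁₂ : u₂ < u₁)
    (huu₁ : u₁ < u) (hW : 8 + u₁ ≤ W) (hr : 0 < r) (hlog : 2 * Real.log r = 1 - W)
    (hc : c = 2 * W / r ^ 2) (hm : W ^ 4 ≤ m) (hur' : u * r ≤ 1 / 2)
    (hsmall : W * r ^ 2 ≤ 3 / 1000) (hmr : 2 * (r ^ 2 * m) ≤ 1)
    (hκ : 3 ≤ ((u - u₁) / 4) ^ 2 * W)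
    (hmain : 2 / Real.exp 1 + 8 * u₁ * r + 16 * r * (W + 2) + 2 * m * r
      ≤ u₂ * (1 - u₁ * r / W)) :
    Tendsto (probIndep c (r ^ 2 * (1 - u * r / W))) atTop (𝓝 1) := by
  have hu₁ : 0 < u₁ := hu₂.trans hu₁₂
  have hW0 : 0 < W := by linarith
  have hur : u₁ * r ≤ 1 / 2 := le_trans (by gcongr) hur'
  have hc0 : 0 < c := by rw [hc]; positivity
  have hm0' : (0 : ℝ) < m := lt_of_lt_of_le (by positivity) hm
  have hm0 : 0 < m := by exact_mod_cast hm0'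
  have h0r : 0 < r ^ 2 := by positivity
  obtain ⟨κ, hκ'⟩ : ∃ κ, κ = (u - u₁) / 4 := ⟨_, rfl⟩
  have hκ0 : 0 < κ := by rw [hκ']; linarith
  rw [← hκ'] at hκ
  set α₁ := r ^ 2 * (1 - u₁ * r / W) with hα₁
  set α₂ := r ^ 2 * (1 - u₂ * r / W) with hα₂
  have hα₁₂ : α₁ < α₂ := by
    have : u₂ * r / W < u₁ * r / W := by gcongr
    exact mul_lt_mul_of_pos_left (by linarith) h0r
  have hα₁0 : 0 < α₁ := by
    have : u₁ * r / W ≤ 1 / 2 := by rw [div_le_iff₀ hW0]; linarith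
    exact mul_pos h0r (by linarith)
  have hα₂r : α₂ ≤ r ^ 2 := by
    have : 0 ≤ u₂ * r / W := by positivity
    have := mul_le_mul_of_nonneg_left (show 1 - u₂ * r / W ≤ 1 by linarith) h0r.le
    linarith
  set τ := κ * r ^ 3 / W with hτ
  have hτ0 : 0 < τ := by positivity
  have hατ : r ^ 2 * (1 - u * r / W) = α₁ - 4 * τ := by
    rw [hα₁, hτ, hκ']; ring
  set β := W * r ^ 6 with hβ
  have hβ0 : 0 < β := by positivity
  -- The choice of `m` makes the deviation inequality beat the second moment bound.
  have hτm : 6 * β ≤ 2 * τ ^ 2 * m := by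
    calc 6 * β = 2 * (3 * W * r ^ 6) := by rw [hβ]; ring
      _ ≤ 2 * ((κ ^ 2 * W) * W * r ^ 6) := by gcongr
      _ = 2 * τ ^ 2 * W ^ 4 := by rw [hτ]; field_simp
      _ ≤ _ := by gcongr
  have hlim : Tendsto (fun n : ℕ => Real.exp (-(6 * β) * n)) atTop (𝓝 0) :=
    Real.tendsto_exp_atBot.comp
      (tendsto_natCast_atTop_atTop.const_mul_atTop_of_neg (by linarith))
  have hpoly : ∀ᶠ n : ℕ in atTop,
      2 * Real.exp (1 + 2 * m + c ^ 2) * ((n : ℝ) ^ 2 * Real.exp (-(2 * β) * n)) < 1 := by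
    have h1 := ((Real.tendsto_pow_mul_exp_neg_atTop_nhds_zero 2).comp
      (tendsto_natCast_atTop_atTop.const_mul_atTop (show 0 < 2 * β by positivity))).const_mul
      (2 * Real.exp (1 + 2 * m + c ^ 2) / (2 * β) ^ 2)
    rw [mul_zero] at h1
    filter_upwards [h1.eventually (gt_mem_nhds zero_lt_one)] with n hn
    refine lt_of_eq_of_lt ?_ hn
    simp only [Function.comp]
    rw [mul_pow, neg_mul]
    field_simp
  have hlow : Tendsto (fun n : ℕ => 1 - Real.exp (-(6 * β) * n)) atTop (𝓝 1) := by
    simpa using hlim.const_sub 1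
  refine tendsto_of_tendsto_of_tendsto_of_le_of_le' hlow tendsto_const_nhds ?_
    (Eventually.of_forall fun n => probIndep_le_one _ _ n)
  have hcast := tendsto_natCast_atTop_atTop (R := ℝ)
  filter_upwards [hpoly, hcast.eventually_ge_atTop (2 * c), eventually_ge_atTop (2 * m),
    hcast.eventually_ge_atTop (1 / (α₂ - α₁)), hcast.eventually_ge_atTop (1 / (2 * τ))]
    with n hn1 hn2 hn3 hn4 hn5
  have hn0 : 0 < n := by omega
  have hn0' : (0 : ℝ) < n := by exact_mod_cast hn0
  set k := ⌈α₁ * n⌉₊ with hk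
  have hkge : α₁ * n ≤ k := Nat.le_ceil _
  have hk0' : (0 : ℝ) < k := lt_of_lt_of_le (by positivity) hkge
  have hk0 : 0 < k := by exact_mod_cast hk0'
  have hkle : (k : ℝ) ≤ α₂ * n := by
    have h1 : (k : ℝ) < α₁ * n + 1 := Nat.ceil_lt_add_one (by positivity)
    rw [div_le_iff₀ (by linarith)] at hn4
    linarith
  have hkm : 2 * (k * m) ≤ n := by
    have h1 : (2 * (k * m) : ℝ) ≤ n := by
      calc (2 * (k * m) : ℝ) ≤ 2 * (r ^ 2 * n * m) := by
            have : (k : ℝ) ≤ r ^ 2 * n := hkle.trans (by gcongr)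
            gcongr
        _ = 2 * (r ^ 2 * m) * n := by ring
        _ ≤ 1 * n := by gcongr
        _ = n := one_mul _
    exact_mod_cast h1
  have hNm : n / m * m ≤ n := Nat.div_mul_le_self n m
  have hN : 0 < n / m := Nat.div_pos (by omega) hm0
  have hN' : (0 : ℝ) < (n / m : ℕ) := by exact_mod_cast hN
  have hNm' : ((n / m : ℕ) : ℝ) * m ≤ n := by exact_mod_cast hNm
  have hsec := exp_neg_le_pi_edgeLaw_real (δ := 4 * W * r ^ 6) hc0 hm0 hn2 hn3 hk0 hkm (by
    intro l hl x α hx hα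
    have hl' : (l : ℝ) ≤ k := by exact_mod_cast hl
    refine overlap_exponent_trichotomy hu₂ hu₁ hW hr hlog hc hm0'.le hur hsmall hmain ?_ ?_ ?_ ?_
    · rw [hα, le_div_iff₀ hn0']; exact hkge
    · rw [hα, div_le_iff₀ hn0']; exact hkle
    · rw [hx]; positivity
    · rw [hx, hα]; gcongr) hNm
  have hdev : Real.exp (-(2 * (τ * n) ^ 2 / (n / m : ℕ))) ≤ Real.exp (-(6 * β) * n) := by
    apply Real.exp_le_exp.2
    rw [neg_mul, neg_le_neg_iff, le_div_iff₀ hN']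
    calc 6 * β * n * (n / m : ℕ) ≤ 2 * τ ^ 2 * m * n * (n / m : ℕ) := by gcongr
      _ = 2 * τ ^ 2 * n * ((n / m : ℕ) * m) := by ring
      _ ≤ 2 * τ ^ 2 * n * n := by gcongr
      _ = _ := by ring
  have hbeat : Real.exp (-(6 * β) * n)
      < ((k + 1) * (n * Real.exp (n * (4 * W * r ^ 6) + (1 + 2 * m + c ^ 2))) : ℝ)⁻¹ := by
    rw [lt_inv_comm₀ (Real.exp_pos _) (by positivity), ← Real.exp_neg]
    have hk1 : (k : ℝ) + 1 ≤ 2 * n := by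
      have h1 : (k : ℝ) ≤ n := by
        have : k ≤ n := by
          have : k * 1 ≤ k * m := Nat.mul_le_mul_left _ hm0
          omega
        exact_mod_cast this
      have h2 : (1 : ℝ) ≤ n := by exact_mod_cast hn0
      linarith
    calc (k + 1) * (n * Real.exp (n * (4 * W * r ^ 6) + (1 + 2 * m + c ^ 2)))
        ≤ 2 * n * (n * Real.exp (n * (4 * W * r ^ 6) + (1 + 2 * m + c ^ 2))) := by gcongr
      _ = 2 * Real.exp (1 + 2 * m + c ^ 2) * ((n : ℝ) ^ 2 * Real.exp (-(2 * β) * n)) *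
            Real.exp (-(-(6 * β) * n)) := by
          rw [show (n : ℝ) * (4 * W * r ^ 6) + (1 + 2 * m + c ^ 2)
            = (1 + 2 * m + c ^ 2) + (-(2 * β) * n + -(-(6 * β) * n)) by rw [hβ]; ring,
            Real.exp_add (1 + 2 * m + c ^ 2), Real.exp_add (-(2 * β) * n)]
          ring
      _ < 1 * Real.exp (-(-(6 * β) * n)) := by gcongr
      _ = _ := one_mul _
  have hfin := one_sub_exp_le_probIndep (c := c) (α := α₁ - 4 * τ) (s := τ * n) hN hNm
    (by positivity) ?_ (hdev.trans_lt (hbeat.trans_le hsec))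
  · rw [hατ]
    linarith
  · rw [div_le_iff₀ (by positivity)] at hn5
    have h0 : 0 ≤ (α₁ - 4 * τ) * n := by
      rw [← hατ]
      have : u * r / W ≤ 1 := by rw [div_le_one hW0]; linarith
      exact mul_nonneg (mul_nonneg h0r.le (by linarith)) hn0'.le
    have := Nat.ceil_lt_add_one h0
    linarith

/-! ### The lower bound in terms of the average degree -/

/-- For `u > 2 / e` all requirements of `tendsto_probIndep_one_of_bounds` hold once `W` is large,
because `r` is exponentially small in `W`. -/
theorem exists_forall_tendsto_probIndep_one {u : ℝ} (hu : 2 / Real.exp 1 < u) :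
    ∃ W₀ : ℝ, ∀ W r : ℝ, W₀ ≤ W → r = Real.exp ((1 - W) / 2) →
      u * r ≤ 1 / 2 ∧
      Tendsto (probIndep (2 * W / r ^ 2) (r ^ 2 * (1 - u * r / W))) atTop (𝓝 1) := by
  obtain ⟨u₁, hu₁, hu₁u⟩ := exists_between hu
  obtain ⟨u₂, hu₂, hu₂₁⟩ := exists_between hu₁
  have hu₂0 : 0 < u₂ := lt_trans (by positivity) hu₂
  have t0 := tendsto_pow_mul_exp_half_atTop 0
  have t1 := tendsto_pow_mul_exp_half_atTop 1
  have t4 := tendsto_pow_mul_exp_half_atTop 4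
  simp only [pow_zero, one_mul, pow_one] at t0 t1
  have e1 : ∀ᶠ W : ℝ in atTop, u * Real.exp ((1 - W) / 2) ≤ 1 / 2 := by
    have := t0.const_mul u
    rw [mul_zero] at this
    exact this.eventually_le_const (by norm_num)
  have e2 : ∀ᶠ W : ℝ in atTop, W * Real.exp ((1 - W) / 2) ^ 2 ≤ 3 / 1000 := by
    have := t1.mul t0
    rw [mul_zero] at this
    filter_upwards [this.eventually_le_const (show (0 : ℝ) < 3 / 1000 by norm_num)] with W hW
    linarith
  have e3 : ∀ᶠ W : ℝ in atTop, 2 * (Real.exp ((1 - W) / 2) ^ 2 * (W ^ 4 + 1)) ≤ 1 := by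
    have := ((t4.mul t0).add (t0.mul t0)).const_mul 2
    simp only [mul_zero, add_zero] at this
    filter_upwards [this.eventually_le_const zero_lt_one] with W hW
    linarith
  -- The left side tends to `2 / e` and the right side to `u₂ > 2 / e`.
  have e4 : ∀ᶠ W : ℝ in atTop, 2 / Real.exp 1 + 8 * u₁ * Real.exp ((1 - W) / 2)
      + 16 * Real.exp ((1 - W) / 2) * (W + 2) + 2 * (W ^ 4 + 1) * Real.exp ((1 - W) / 2)
      ≤ u₂ * (1 - u₁ * Real.exp ((1 - W) / 2)) := by
    have := ((((t0.const_mul (8 * u₁)).add (t1.const_mul 16)).add (t0.const_mul 34)).add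
      (t4.const_mul 2)).add (t0.const_mul (u₂ * u₁))
    simp only [mul_zero, add_zero] at this
    filter_upwards [this.eventually_le_const (sub_pos.2 hu₂)] with W hW
    linarith
  have e5 : ∀ᶠ W : ℝ in atTop, 3 / ((u - u₁) / 4) ^ 2 ≤ W := eventually_ge_atTop _
  obtain ⟨W₀, hW₀⟩ := eventually_atTop.1
    (e1.and (e2.and (e3.and (e4.and (e5.and (eventually_ge_atTop (8 + u₁)))))))
  refine ⟨W₀, fun W r hW hr => ?_⟩
  obtain ⟨h1, h2, h3, h4, h5, h6⟩ := hW₀ W hW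
  rw [← hr] at h1 h2 h3 h4
  have hr0 : 0 < r := hr ▸ Real.exp_pos _
  have hW1 : 1 ≤ W := by linarith
  have hceil : (⌈W ^ 4⌉₊ : ℝ) ≤ W ^ 4 + 1 := (Nat.ceil_lt_add_one (by positivity)).le
  refine ⟨h1, tendsto_probIndep_one_of_bounds (m := ⌈W ^ 4⌉₊) hu₂0 hu₂₁ hu₁u h6 hr0 ?_ rfl
    (Nat.le_ceil _) h1 h2 ?_ ?_ ?_⟩
  · rw [hr, Real.log_exp]; ring
  · refine le_trans ?_ h3
    gcongr
  · have : 0 < (u - u₁) / 4 := by linarith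
    rw [div_le_iff₀ (by positivity)] at h5
    linarith
  · refine le_trans ?_ (h4.trans ?_)
    · gcongr
    · have hu₁0 : 0 < u₁ := hu₂0.trans hu₂₁
      have : u₁ * r / W ≤ u₁ * r := div_le_self (by positivity) hW1
      gcongr

/-- In the parametrization `c = 2 * W / r ^ 2` the term `√(log c) / c ^ (3 / 2)` is at least
`r ^ 3 / (2 * √2 * W)`. -/
theorem mul_cube_div_le {W r c y : ℝ} (hW : 2 ≤ W) (hr : r = Real.exp ((1 - W) / 2))
    (hc : c = 2 * W / r ^ 2) (hy : 0 ≤ y) :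
    y / (2 * √2) * r ^ 3 / W ≤ y * (√(Real.log c) / c ^ (3 / 2 : ℝ)) := by
  have hr0 : 0 < r := hr ▸ Real.exp_pos _
  have hW0 : 0 < W := by linarith
  have hc0 : 0 < c := by rw [hc]; positivity
  have hlog : W ≤ Real.log c := by
    rw [hc, Real.log_div (by positivity) (by positivity), Real.log_pow, hr, Real.log_exp]
    have h1 : Real.log (Real.exp 1) ≤ Real.log (2 * W) :=
      Real.log_le_log (Real.exp_pos 1) (by linarith [Real.exp_one_lt_d9])
    rw [Real.log_exp] at h1
    push_cast
    linarith
  have hpow : c ^ (3 / 2 : ℝ) = 2 * √2 * W * √W / r ^ 3 := by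
    have h1 : c ^ (3 / 2 : ℝ) = c * √c := by
      rw [show (3 / 2 : ℝ) = 1 + 1 / 2 by norm_num, Real.rpow_add hc0, Real.rpow_one,
        Real.sqrt_eq_rpow]
    rw [h1, hc, Real.sqrt_div (by positivity), Real.sqrt_sq hr0.le,
      Real.sqrt_mul (by norm_num)]
    field_simp
  have hsW : 0 < √W := Real.sqrt_pos.2 hW0
  calc y / (2 * √2) * r ^ 3 / W = y * (√W / c ^ (3 / 2 : ℝ)) := by
        rw [hpow]; field_simp
    _ ≤ _ := by
        gcongr

theorem exists_forall_sub_le_alphaCritLower {y : ℝ} (hy : 4 * √2 / Real.exp 1 < y) :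
    ∃ c₀ : ℝ, 0 < c₀ ∧ ∀ c : ℝ, c₀ ≤ c →
      2 / c * lambertW (Real.exp 1 * c / 2) - y * (√(Real.log c) / c ^ (3 / 2 : ℝ))
        ≤ alphaCritLower c := by
  have hs2 : (√2 : ℝ) * √2 = 2 := Real.mul_self_sqrt (by norm_num)
  have hs0 : (0 : ℝ) < √2 := by positivity
  have hu : 2 / Real.exp 1 < y / (2 * √2) := by
    rw [lt_div_iff₀ (by positivity)]
    refine lt_of_eq_of_lt ?_ hy
    ring
  have hy0 : 0 < y := lt_trans (by positivity) hy
  obtain ⟨W₀, hW₀⟩ := exists_forall_tendsto_probIndep_one hu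
  set W₁ := max W₀ 2 with hW₁
  have hW₁2 : 2 ≤ W₁ := le_max_right _ _
  refine ⟨2 * (W₁ * Real.exp W₁) / Real.exp 1, by positivity, fun c hc => ?_⟩
  have hc0 : 0 < c := lt_of_lt_of_le (by positivity) hc
  have hz : 0 < Real.exp 1 * c / 2 := by positivity
  have hWpos := lambertW_pos hz
  have hWz := lambertW_mul_exp hz
  have hup := tendsto_probIndep_zero_of_lambertW_lt hc0
    (lt_add_one (2 / c * lambertW (Real.exp 1 * c / 2)))
  set W := lambertW (Real.exp 1 * c / 2)
  have hWge : W₁ ≤ W := by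
    by_contra! hlt
    rw [div_le_iff₀ (Real.exp_pos 1)] at hc
    have : W * Real.exp W < W₁ * Real.exp W₁ :=
      mul_lt_mul hlt (Real.exp_le_exp.2 hlt.le) (Real.exp_pos _) (by linarith)
    linarith
  have hW2 : 2 ≤ W := hW₁2.trans hWge
  obtain ⟨r, hr⟩ : ∃ r, r = Real.exp ((1 - W) / 2) := ⟨_, rfl⟩
  have hr0 : 0 < r := hr ▸ Real.exp_pos _
  have hr2 : r ^ 2 = Real.exp 1 / Real.exp W := by
    rw [hr, ← Real.exp_nat_mul, ← Real.exp_sub]; congr 1; push_cast; ring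
  have hcr : c = 2 * W / r ^ 2 := by
    rw [hr2]
    field_simp
    linarith
  have ha : 2 / c * W = r ^ 2 := by
    rw [hcr]; field_simp
  obtain ⟨h1, h2⟩ := hW₀ W r ((le_max_left _ _).trans hWge) hr
  rw [← hcr] at h2
  have h3 := mul_cube_div_le hW2 hr hcr hy0.le
  have h4 : 0 ≤ r ^ 2 * (1 - y / (2 * √2) * r / W) := by
    have : y / (2 * √2) * r / W ≤ 1 := by
      rw [div_le_one (by linarith)]; linarith
    exact mul_nonneg (sq_nonneg r) (by linarith)
  refine le_trans ?_ (le_alphaCritLower h4 h2 hup)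
  have h5 : r ^ 2 * (1 - y / (2 * √2) * r / W) = r ^ 2 - y / (2 * √2) * r ^ 3 / W := by ring
  rw [ha, h5]
  linarith

end IndepSetThreshold

theorem corollary1 :
    (∀ c : ℝ, 0 < c →
      IndepSetThreshold.alphaCritLower c ≤ IndepSetThreshold.alphaCritUpper c ∧
      IndepSetThreshold.alphaCritUpper c
        ≤ 2 / c * IndepSetThreshold.lambertW (Real.exp 1 * c / 2)) ∧
    (∀ y : ℝ, 4 * √2 / Real.exp 1 < y → ∃ c₀ : ℝ, 0 < c₀ ∧ ∀ c : ℝ, c₀ ≤ c →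
      2 / c * IndepSetThreshold.lambertW (Real.exp 1 * c / 2)
          - y * (√(Real.log c) / c ^ (3 / 2 : ℝ))
        ≤ IndepSetThreshold.alphaCritLower c) ∧
    (∀ c : ℝ, 0 < c → ∀ a : ℝ, IndepSetThreshold.IsAlphaCrit c a →
      IndepSetThreshold.alphaCritLower c = a ∧ IndepSetThreshold.alphaCritUpper c = a) := by
  refine ⟨fun c hc => ?_, fun y hy => IndepSetThreshold.exists_forall_sub_le_alphaCritLower hy,
    fun c _ a h => h.alphaCritLower_eq_and_alphaCritUpper_eq⟩
  have hpos : 0 ≤ 2 / c * IndepSetThreshold.lambertW (Real.exp 1 * c / 2) :=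
    mul_nonneg (by positivity) (IndepSetThreshold.lambertW_pos (by positivity)).le
  refine ⟨IndepSetThreshold.alphaCritLower_le_alphaCritUpper (add_nonneg hpos zero_le_one)
    (IndepSetThreshold.tendsto_probIndep_zero_of_lambertW_lt hc (lt_add_one _)), ?_⟩
  exact le_of_forall_gt_imp_ge_of_dense fun t ht =>
    IndepSetThreshold.alphaCritUpper_le (hpos.trans ht.le)
      (IndepSetThreshold.tendsto_probIndep_zero_of_lambertW_lt hc ht)
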